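/- **Mechanisms and privacy.** A dataset is $D=(x_1,\dots,x_N)$ with $x_n\in\mathbb R^d$, $\|x_n\|_2\le 1$; $D,D'$ are adjacent if their Hamming distance is $1$. A mechanism $M$ is $(\varepsilon,\delta)$-differentially private if $\Pr[M(D)\in S]\le e^{\varepsilon}\Pr[M(D')\in S]+\delta$ for all adjacent $D,D'$ and all measurable $S$. For a mechanism $M(a,D)$ with an auxiliary input $a$ (the earlier outputs) and $\ell>0$ put $$MA_M(\ell)=\sup_{a}\ \sup_{D,D'\text{ adjacent}}\ \log \mathbb E_{z\sim M(a,D)}\left[\left(\frac{dM(a,D)}{dM(a,D')}(z)\right)^{\ell}\right],$$ the expectation being $+\infty$ if $M(a,D)\not\ll M(a,D')$. For $C>0$ let $\psi_C(v)=v/\max(1,\|v\|_2/C)$ (Frobenius norm for matrices). **P3GM.** Let $\sigma_p,\sigma_e,\sigma_s>0$, $C,C_\pi,C_\mu,C_\Sigma>0$, integers $1\le B\le N$, learning rates $\eta_t\in\mathbb R$, a fixed centre $\mu_X\in\mathbb R^d$ and fixed initial values $\lambda_0,\theta_0$ be given. All noises below are independent. P3GM runs three phases. 1. *DP-PCA.*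 It computes $\hat A=A+E$, where $A=\frac1N\sum_n(x_n-\bar x)(x_n-\bar x)^{\mathsf T}$, $\bar x=\frac1N\sum_n x_n$, and $E$ is symmetric with entries on and above the diagonal i.i.d. $\mathcal N(0,\sigma_p^2)$. With $W=W(\hat A)\in\mathbb R^{d\times d'}$ having as columns orthonormal eigenvectors of $\hat A$ for its $d'$ largest eigenvalues (chosen measurably), put $\hat x_n=W^{\mathsf T}(x_n-\mu_X)$. 2. *DP-EM, $T_e$ steps.* The state is $\lambda=(\pi_k,\mu_k,\Sigma_k)_{k\le K}$, the parameters of a mixture of $K$ Gaussians on $\mathbb R^{d'}$. One step computes from $\lambda$ and $\hat x_1,\dots,\hat x_N$ the usual EM (maximum likelihood) update, clips the weight vector by $\psi_{C_\pi}$, each mean by $\psi_{C_\mu}$ and each covariance matrix by $\psi_{C_\Sigma}$, and adds Gaussian noise to each of these $2K+1$ blocks, with standard deviation $\sigma_e$ times the sensitivity bound $2C_\pi$, $2C_\mu$, $2C_\Sigma$ per coordinate, respectively (for a covariance matrix: a symmetric noise matrix with independent entries on and above the diagonal). 3. *DP-SGD, $T_s$ steps.* The state is $\theta\in\mathbb R^p$,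 the parameters of a Gaussian encoder $q_\theta(z|x)=\mathcal N(\hat x,\operatorname{diag}v_\theta(x))$ and a Gaussian decoder $p_\theta(x|z)$ with mean and diagonal variance given by arbitrary networks. One step draws a batch $S\subseteq\{1,\dots,N\}$ from a fixed law with $\Pr[n\in S]=B/N$ for every $n$, forms $\tilde g=\frac1B\big(\sum_{b\in S}\psi_C(g_b)+\mathcal N(0,\sigma_s^2C^2I)\big)$, where $$g_b=\nabla_\theta\Big[\tfrac1L\sum_{l=1}^L\log p_\theta(x_b|z_{b,l})+\log\sum_{k}\pi_k\exp\big(-D_{\mathrm{KL}}(q_\theta(z|x_b)\,\|\,\mathcal N(\mu_k,\Sigma_k))\big)\Big],\qquad z_{b,l}=\hat x_b+\sqrt{v_\theta(x_b)}\,\xi_{b,l},$$ with $\xi_{b,l}$ i.i.d. standard Gaussian (the gradient is assumed to be a measurable function of its arguments), and sets $\theta\leftarrow\theta-\eta_t\tilde g$. The output is the final $(\theta,\lambda)$. Let $MA_{\text{DP-EM}}$ be the moment $MA$ of one DP-EM step (from $D$ to the noisy $\lambda$, with auxiliary input $\hat A$ and the current $\lambda$), and $MA_{\text{DP-SGD}}$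 that of one DP-SGD step (from $D$ to $\tilde g$, with auxiliary input $\hat A$, the released $\lambda$ and the current $\theta$). **Theorem.** For all $T_e,T_s\ge 0$, $0<\delta<1$ and $\alpha>1$, the moments $MA_{\text{DP-EM}}(\alpha-1)$ and $MA_{\text{DP-SGD}}(\alpha-1)$ are not $+\infty$, and P3GM satisfies $(\varepsilon,\delta)$-differential privacy with $$\varepsilon=\frac{\alpha}{2\sigma_p^2}+T_s\,\frac{MA_{\text{DP-SGD}}(\alpha-1)}{\alpha-1}+T_e\,\frac{MA_{\text{DP-EM}}(\alpha-1)}{\alpha-1}+\frac{\log(1/\delta)}{\alpha-1}.$$ (If there are no adjacent datasets, which happens only for $d=0$, the claim is empty and the moments are read as $0$.) -/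

import Mathlib

open MeasureTheory ProbabilityTheory
open scoped ENNReal NNReal

noncomputable section

namespace P3GM

/-! ### Differential privacy and the moments accountant -/

open Classical in
/-- Two datasets of `N` records are adjacent if their Hamming distance is one. -/
def Adjacent {N : ℕ} {X : Type*} (D D' : Fin N → X) : Prop :=
  hammingDist D D' = 1

/-- `(ε, δ)`-differential privacy of a randomized mechanism, given by its output laws. -/
def IsDP {N : ℕ} {X Z : Type*} [MeasurableSpace Z]
    (M : (Fin N → X) → Measure Z) (ε δ : ℝ) : Prop :=
  ∀ D D' : Fin N → X, Adjacent D D' → ∀ S : Set Z, MeasurableSet S →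
    M D S ≤ ENNReal.ofReal (Real.exp ε) * M D' S + ENNReal.ofReal δ

open Classical in
/-- `E_{z ∼ P} exp (l * log (dP/dQ z)) = E_{z ∼ P} (dP/dQ z) ^ l` for `l > 0`; it is infinite if
`P` is not absolutely continuous with respect to `Q`. -/
def lossMoment {Z : Type*} [MeasurableSpace Z] (l : ℝ) (P Q : Measure Z) : ℝ≥0∞ :=
  if P ≪ Q then ∫⁻ z, (P.rnDeriv Q z) ^ l ∂P else ⊤

/-- The `l`-th moment `MA_M(l)` of a mechanism `M` that also receives an auxiliary input (the
outputs released before): the supremum of the log moments of the privacy loss over all auxiliary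
inputs and all adjacent datasets. -/
def MA {N : ℕ} {Aux X Z : Type*} [MeasurableSpace Z]
    (M : Aux → (Fin N → X) → Measure Z) (l : ℝ) : EReal :=
  ⨆ (a : Aux) (D : Fin N → X) (D' : Fin N → X) (_ : Adjacent D D'),
    ENNReal.log (lossMoment l (M a D) (M a D'))

/-! ### Vectors, clipping, Gaussian noise -/

/-- Euclidean norm (on `ι = Fin m × Fin m`: the Frobenius norm). -/
def l2norm {ι : Type*} [Fintype ι] (v : ι → ℝ) : ℝ := ‖WithLp.toLp 2 v‖

/-- Norm clipping `ψ_C(v) = v / max(1, ‖v‖₂ / C)`. -/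
def clip {ι : Type*} [Fintype ι] (C : ℝ) (v : ι → ℝ) : ι → ℝ :=
  (max 1 (l2norm v / C))⁻¹ • v

/-- `N(0, σ² I)` on `ι → ℝ`. -/
def gaussianNoise (ι : Type*) [Fintype ι] (σ : ℝ) : Measure (ι → ℝ) :=
  Measure.pi fun _ => gaussianReal 0 (Real.toNNReal (σ ^ 2))

/-- The symmetric matrix whose entries on and above the diagonal are listed by `e`. -/
def symm {n : ℕ} (e : Sym2 (Fin n) → ℝ) : Fin n → Fin n → ℝ := fun i j => e s(i, j)

/-- Data records: vectors of Euclidean norm at most one. -/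
abbrev Rec (d : ℕ) := {x : Fin d → ℝ // l2norm x ≤ 1}

/-! ### Differentially private PCA -/

/-- The mean of the records. -/
def mean {N d : ℕ} (D : Fin N → Rec d) : Fin d → ℝ :=
  fun j => (∑ n, (D n).1 j) / N

/-- The covariance matrix of the records. -/
def covariance {N d : ℕ} (D : Fin N → Rec d) : Fin d → Fin d → ℝ :=
  fun i j => (∑ n, ((D n).1 i - mean D i) * ((D n).1 j - mean D j)) / N

/-- DP-PCA releases `A + E`, with `A` the covariance matrix and `E` a symmetric matrix whose
entries on and above the diagonal are i.i.d. `N(0, σ²)`. -/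
def dpPCA {N d : ℕ} (σ : ℝ) (D : Fin N → Rec d) : Measure (Fin d → Fin d → ℝ) :=
  (gaussianNoise (Sym2 (Fin d)) σ).map fun e => covariance D + symm e

/-- The columns of `W` are `m` orthonormal eigenvectors of `S` for its `m` largest eigenvalues. -/
def IsPrincipal {d m : ℕ} (S : Matrix (Fin d) (Fin d) ℝ) (W : Matrix (Fin d) (Fin m) ℝ) : Prop :=
  W.transpose * W = 1 ∧
  ∃ ev : Fin m → ℝ, S * W = W * Matrix.diagonal ev ∧
    ∀ v : Fin d → ℝ, W.transpose.mulVec v = 0 → ∀ j, v ⬝ᵥ S.mulVec v ≤ ev j * (v ⬝ᵥ v)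

/-- Coordinates of `x - c` along the columns of `W`. -/
def reduce {d m : ℕ} (W : Fin d → Fin m → ℝ) (c x : Fin d → ℝ) : Fin m → ℝ :=
  fun j => ∑ i, W i j * (x i - c i)

/-! ### Mixtures of Gaussians and the EM update -/

/-- Parameters `(π, μ, Σ)` of a mixture of `K` Gaussians in dimension `m`. -/
abbrev MoG (K m : ℕ) :=
  (Fin K → ℝ) × (Fin K → Fin m → ℝ) × (Fin K → Fin m → Fin m → ℝ)

/-- `(z - μ)ᵀ Σ⁻¹ (z - μ)`. -/
def mahalanobis {m : ℕ} (μ : Fin m → ℝ) (S : Fin m → Fin m → ℝ) (z : Fin m → ℝ) : ℝ :=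
  (z - μ) ⬝ᵥ (Matrix.of S)⁻¹.mulVec (z - μ)

/-- Density of `N(μ, Σ)` at `z`. -/
def gaussianDensity {m : ℕ} (μ : Fin m → ℝ) (S : Fin m → Fin m → ℝ) (z : Fin m → ℝ) : ℝ :=
  Real.exp (-(mahalanobis μ S z) / 2) /
    Real.sqrt ((2 * Real.pi) ^ m * (Matrix.of S).det)

/-- E step: the responsibility of component `k` for the point `z`. -/
def resp {K m : ℕ} (lam : MoG K m) (z : Fin m → ℝ) (k : Fin K) : ℝ :=
  lam.1 k * gaussianDensity (lam.2.1 k) (lam.2.2 k) z /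
    ∑ j, lam.1 j * gaussianDensity (lam.2.1 j) (lam.2.2 j) z

/-- Total responsibility of component `k`. -/
def respSum {N K m : ℕ} (lam : MoG K m) (z : Fin N → Fin m → ℝ) (k : Fin K) : ℝ :=
  ∑ n, resp lam (z n) k

/-- M step: maximum likelihood estimate of the weights. -/
def mleWeight {N K m : ℕ} (lam : MoG K m) (z : Fin N → Fin m → ℝ) : Fin K → ℝ :=
  fun k => respSum lam z k / N

/-- M step: maximum likelihood estimate of the mean of component `k`. -/
def mleMean {N K m : ℕ} (lam : MoG K m) (z : Fin N → Fin m → ℝ) (k : Fin K) : Fin m → ℝ :=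
  fun i => (∑ n, resp lam (z n) k * z n i) / respSum lam z k

/-- M step: maximum likelihood estimate of the covariance of component `k`. -/
def mleCov {N K m : ℕ} (lam : MoG K m) (z : Fin N → Fin m → ℝ) (k : Fin K) :
    Fin m → Fin m → ℝ :=
  fun i j => (∑ n, resp lam (z n) k *
    ((z n i - mleMean lam z k i) * (z n j - mleMean lam z k j))) / respSum lam z k

/-- The EM update, with each of its `2K + 1` blocks clipped; `C = (C_π, C_μ, C_Σ)`. -/
def emUpdate {N K m : ℕ} (C : ℝ × ℝ × ℝ) (lam : MoG K m) (z : Fin N → Fin m → ℝ) : MoG K m :=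
  (clip C.1 (mleWeight lam z),
   fun k => clip C.2.1 (mleMean lam z k),
   fun k => Function.curry (clip C.2.2 (Function.uncurry (mleCov lam z k))))

/-- The noise of one DP-EM step. A block clipped at `C` has sensitivity (at most) `2C`; its noise
is `σ` times that. The noise of a covariance block is symmetric. -/
def emNoise (K m : ℕ) (C : ℝ × ℝ × ℝ) (σ : ℝ) : Measure (MoG K m) :=
  (gaussianNoise (Fin K) (2 * C.1 * σ)).prod
    ((Measure.pi fun _ : Fin K => gaussianNoise (Fin m) (2 * C.2.1 * σ)).prod
      (Measure.pi fun _ : Fin K => (gaussianNoise (Sym2 (Fin m)) (2 * C.2.2 * σ)).map symm))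

/-! ### The training objective -/

/-- KL divergence from `N(z, diag v)` to `N(μ, Σ)`. -/
def klGaussian {m : ℕ} (z v : Fin m → ℝ) (μ : Fin m → ℝ) (S : Fin m → Fin m → ℝ) : ℝ :=
  (((Matrix.of S)⁻¹ * Matrix.diagonal v).trace + mahalanobis μ S z - m
    + Real.log (Matrix.of S).det - ∑ i, Real.log (v i)) / 2

/-- The approximation `- log ∑_k π_k exp (- KL(N(z, diag v) ‖ N(μ_k, Σ_k)))` of the KL divergence
from `N(z, diag v)` to the mixture. -/
def klMoG {K m : ℕ} (z v : Fin m → ℝ) (lam : MoG K m) : ℝ :=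
  -Real.log (∑ k, lam.1 k * Real.exp (-klGaussian z v (lam.2.1 k) (lam.2.2 k)))

/-- Log-density of `N(μ, diag v)` at `x`. -/
def logGaussian {d : ℕ} (μ v x : Fin d → ℝ) : ℝ :=
  -(∑ i, ((x i - μ i) ^ 2 / v i + Real.log (2 * Real.pi * v i))) / 2

/-- The gradient of a function of `θ`, as the vector of its partial derivatives. -/
def grad {p : ℕ} (f : (Fin p → ℝ) → ℝ) (θ : Fin p → ℝ) : Fin p → ℝ :=
  fun j => fderiv ℝ f θ (Pi.single j 1)

/-! ### The pipeline -/

/-- The hyperparameters, networks and initial values of P3GM, for `N` records in dimension `d`,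
reduced dimension `m`, `p` trained parameters, `K` mixture components and `L` Monte Carlo samples
per gradient. -/
structure Config (N d m p K L : ℕ) where
  /-- noise scales of DP-PCA, DP-EM and DP-SGD -/
  σp : ℝ
  σe : ℝ
  σs : ℝ
  /-- principal component analysis: the `m` leading eigenvectors, as columns -/
  pca : (Fin d → Fin d → ℝ) → Fin d → Fin m → ℝ
  /-- the centre used in the dimensional reduction -/
  center : Fin d → ℝ
  /-- clipping sizes of the weights, means and covariances in DP-EM -/
  clipEM : ℝ × ℝ × ℝ
  /-- initial mixture parameters -/
  lam₀ : MoG K m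
  /-- variance network of the encoder; its mean is the reduced record -/
  encVar : (Fin p → ℝ) → (Fin d → ℝ) → Fin m → ℝ
  /-- mean and variance networks of the decoder -/
  decMean : (Fin p → ℝ) → (Fin m → ℝ) → Fin d → ℝ
  decVar : (Fin p → ℝ) → (Fin m → ℝ) → Fin d → ℝ
  /-- initial network parameters -/
  θ₀ : Fin p → ℝ
  /-- batch size and law of the random batch -/
  B : ℕ
  batch : PMF (Finset (Fin N))
  /-- gradient norm bound and learning rates -/
  C : ℝ
  η : ℕ → ℝ

namespace Config

variable {N d m p K L : ℕ} (c : Config N d m p K L)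

/-- Reduction of a record by means of the released matrix `A`. -/
def enc (A : Fin d → Fin d → ℝ) (x : Rec d) : Fin m → ℝ := reduce (c.pca A) c.center x.1

/-- The Monte Carlo evidence lower bound at a record `x` with reduced record `z` and prior
`MoG(lam)`; `ξ` holds the standard Gaussian samples of the reparametrization
`z_l = z + √var · ξ_l`. -/
def elbo (θ : Fin p → ℝ) (x : Fin d → ℝ) (z : Fin m → ℝ) (lam : MoG K m)
    (ξ : Fin L → Fin m → ℝ) : ℝ :=
  (∑ l, logGaussian
      (c.decMean θ (fun i => z i + Real.sqrt (c.encVar θ x i) * ξ l i))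
      (c.decVar θ (fun i => z i + Real.sqrt (c.encVar θ x i) * ξ l i)) x) / L
    - klMoG z (c.encVar θ x) lam

/-- The gradient of the evidence lower bound in the network parameters. -/
def elboGrad (θ : Fin p → ℝ) (x : Fin d → ℝ) (z : Fin m → ℝ) (lam : MoG K m)
    (ξ : Fin L → Fin m → ℝ) : Fin p → ℝ :=
  grad (fun θ' => c.elbo θ' x z lam ξ) θ

/-- One DP-EM step. Auxiliary input: the output of DP-PCA and the current mixture. -/
def emStep (a : (Fin d → Fin d → ℝ) × MoG K m) (D : Fin N → Rec d) : Measure (MoG K m) :=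
  (emNoise K m c.clipEM c.σe).map fun Y =>
    emUpdate c.clipEM a.2 (fun n => c.enc a.1 (D n)) + Y

/-- One DP-SGD step: the law of the noisy average gradient
`B⁻¹ (∑_{b ∈ batch} ψ_C(g_b) + N(0, σ_s² C² I))`. Auxiliary input: the output of DP-PCA, the
mixture released by DP-EM and the current network parameters. -/
def sgdStep (a : (Fin d → Fin d → ℝ) × MoG K m × (Fin p → ℝ)) (D : Fin N → Rec d) :
    Measure (Fin p → ℝ) :=
  ∑ S : Finset (Fin N), c.batch S •
    ((Measure.pi fun _ : Fin N => Measure.pi fun _ : Fin L => gaussianNoise (Fin m) 1).prod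
      (gaussianNoise (Fin p) (c.σs * c.C))).map fun w =>
        (c.B : ℝ)⁻¹ •
          ((∑ b ∈ S, clip c.C (c.elboGrad a.2.2 (D b).1 (c.enc a.1 (D b)) a.2.1 (w.1 b))) + w.2)

/-- Law of the mixture after `t` steps of DP-EM. -/
def dpEM (A : Fin d → Fin d → ℝ) (D : Fin N → Rec d) : ℕ → Measure (MoG K m)
  | 0 => Measure.dirac c.lam₀
  | t + 1 => (dpEM A D t).bind fun lam => c.emStep (A, lam) D

/-- Law of the network parameters after `t` steps of DP-SGD, `θ_{t+1} = θ_t - η_t g_t`. -/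
def dpSGD (A : Fin d → Fin d → ℝ) (lam : MoG K m) (D : Fin N → Rec d) :
    ℕ → Measure (Fin p → ℝ)
  | 0 => Measure.dirac c.θ₀
  | t + 1 => (dpSGD A lam D t).bind fun θ =>
      (c.sgdStep (A, lam, θ) D).map fun g => θ - c.η t • g

/-- P3GM: DP-PCA, then `Te` steps of DP-EM on the reduced records, then `Ts` steps of DP-SGD. The
output consists of the network parameters and the mixture parameters. -/
def p3gm (Te Ts : ℕ) (D : Fin N → Rec d) : Measure ((Fin p → ℝ) × MoG K m) :=
  (dpPCA c.σp D).bind fun A =>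
    (c.dpEM A D Te).bind fun lam =>
      (c.dpSGD A lam D Ts).map fun θ => (θ, lam)

end Config

end P3GM

end

/-!
A bound `ρ` on the Rényi divergence of order `α` of `P` from `Q` is equivalent, by duality, to the
Hölder-type inequality `∫ f dP ≤ exp (ρ / β) (∫ f ^ β dQ) ^ (1 / β)` for all `f ≥ 0`, where `β` is
conjugate to `α`. In this form post-processing is a substitution, and adaptive composition is two
applications of the inequality, one inside the other; hence the bounds of the successive steps add
up. Young's inequality applied to the indicator of an event turns the total into
`(ε, δ)`-privacy. A finite moment `MA(α - 1)` is, by definition, a Rényi bound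
`MA(α - 1) / (α - 1)` for one step, and it is finite because every step adds Gaussian noise to a
quantity of bounded sensitivity. For DP-PCA the sensitivity is at most `1`: the covariance is
`(2 N²)⁻¹ ∑ u uᵀ` over all differences `u = xₙ - xₙ'`, replacing one record changes `2 (N - 1)` of
these terms, each by at most `4` in Frobenius norm, and `8 (N - 1) ≤ 2 N²`.
-/

namespace P3GM

theorem ofReal_exp_mul_ofReal_exp (x y : ℝ) :
    ENNReal.ofReal (Real.exp x) * ENNReal.ofReal (Real.exp y) =
      ENNReal.ofReal (Real.exp (x + y)) := by
  rw [← ENNReal.ofReal_mul (Real.exp_nonneg x), ← Real.exp_add]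

theorem ofReal_exp_rpow (x y : ℝ) :
    ENNReal.ofReal (Real.exp x) ^ y = ENNReal.ofReal (Real.exp (x * y)) := by
  rw [ENNReal.ofReal_rpow_of_pos (Real.exp_pos x), ← Real.exp_mul]

theorem le_rpow_of_le_mul_rpow_inv_conjExponent {α : ℝ} (hα : 1 < α) {J K : ℝ≥0∞} (hJ : J ≠ ⊤)
    (h : J ≤ K * J ^ α.conjExponent⁻¹) : J ≤ K ^ α := by
  have hαβ := Real.HolderConjugate.conjExponent hα
  rcases eq_or_ne J 0 with rfl | hJ0
  · exact zero_le
  have hsplit : J = J ^ α⁻¹ * J ^ α.conjExponent⁻¹ := by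
    rw [← ENNReal.rpow_add _ _ hJ0 hJ, hαβ.inv_add_inv_eq_one, ENNReal.rpow_one]
  have hroot : J ^ α⁻¹ ≤ K := by
    refine (ENNReal.mul_le_mul_iff_left (ENNReal.rpow_pos (pos_iff_ne_zero.2 hJ0) hJ).ne'
      (ENNReal.rpow_ne_top_of_nonneg hαβ.symm.inv_nonneg hJ)).1 (hsplit ▸ h)
  exact (ENNReal.rpow_inv_le_iff hαβ.pos).1 hroot

theorem lintegral_rnDeriv_rpow_sub_one {Z : Type*} [MeasurableSpace Z] {α : ℝ} (hα : 1 ≤ α)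
    {P Q : Measure Z} [P.HaveLebesgueDecomposition Q] (hPQ : P ≪ Q) :
    ∫⁻ z, P.rnDeriv Q z ^ (α - 1) ∂P = ∫⁻ z, P.rnDeriv Q z ^ α ∂Q := by
  have hr := Measure.measurable_rnDeriv P Q
  rw [← lintegral_rnDeriv_mul hPQ (hr.pow_const _).aemeasurable]
  refine lintegral_congr fun z => ?_
  nth_rw 1 [← ENNReal.rpow_one (P.rnDeriv Q z)]
  rw [← ENNReal.rpow_add_of_nonneg _ _ zero_le_one (sub_nonneg.2 hα), add_sub_cancel]

/-- `RenyiDivLE α ρ P Q` says that the Rényi divergence of order `α` of `P` from `Q` is at most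
`ρ`. The bound `(∫ (dP/dQ) ^ α dQ) ^ (1 / α) ≤ exp (ρ / β)`, with `β` conjugate to `α`, is encoded
by its dual: every test function is integrated by `P` to at most `exp (ρ / β)` times its
`L^β(Q)`-seminorm. -/
def RenyiDivLE {Z : Type*} [MeasurableSpace Z] (α ρ : ℝ) (P Q : Measure Z) : Prop :=
  ∀ f : Z → ℝ≥0∞, Measurable f →
    ∫⁻ z, f z ∂P ≤ ENNReal.ofReal (Real.exp (ρ / α.conjExponent)) *
      (∫⁻ z, f z ^ α.conjExponent ∂Q) ^ α.conjExponent⁻¹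

namespace RenyiDivLE

variable {Y Z : Type*} [MeasurableSpace Y] [MeasurableSpace Z] {α ρ ρ' : ℝ}

theorem mono (hα : 1 < α) {P Q : Measure Z} (h : RenyiDivLE α ρ P Q) (hρ : ρ ≤ ρ') :
    RenyiDivLE α ρ' P Q := fun f hf => by
  have := (Real.HolderConjugate.conjExponent hα).symm.nonneg
  exact (h f hf).trans (by gcongr)

theorem withDensity (hα : 1 < α) {Q : Measure Z} {r : Z → ℝ≥0∞} (hr : Measurable r)
    (h : ∫⁻ z, r z ^ α ∂Q ≤ ENNReal.ofReal (Real.exp ((α - 1) * ρ))) :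
    RenyiDivLE α ρ (Q.withDensity r) Q := by
  intro f hf
  have hαβ := Real.HolderConjugate.conjExponent hα
  rw [lintegral_withDensity_eq_lintegral_mul _ hr hf]
  refine (ENNReal.lintegral_mul_le_Lp_mul_Lq Q hαβ hr.aemeasurable hf.aemeasurable).trans ?_
  simp only [one_div]
  gcongr
  refine (ENNReal.rpow_le_rpow h hαβ.inv_nonneg).trans_eq ?_
  rw [ofReal_exp_rpow, ← hαβ.div_conj_eq_sub_one]
  congr 2
  field [hαβ.ne_zero]

theorem refl (hα : 1 < α) (P : Measure Z) [IsProbabilityMeasure P] : RenyiDivLE α 0 P P := by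
  simpa using withDensity hα (Q := P) (r := 1) (ρ := 0) measurable_one (by simp)

theorem map {P Q : Measure Z} (h : RenyiDivLE α ρ P Q) {g : Z → Y} (hg : Measurable g) :
    RenyiDivLE α ρ (P.map g) (Q.map g) := by
  intro f hf
  rw [lintegral_map hf hg, lintegral_map (hf.pow_const _) hg]
  exact h _ (hf.comp hg)

theorem bind (hα : 1 < α) {P Q : Measure Y} (h : RenyiDivLE α ρ P Q) {κ κ' : Y → Measure Z}
    (hκ : Measurable κ) (hκ' : Measurable κ') (h' : ∀ y, RenyiDivLE α ρ' (κ y) (κ' y)) :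
    RenyiDivLE α (ρ + ρ') (P.bind κ) (Q.bind κ') := by
  intro f hf
  have hβ := (Real.HolderConjugate.conjExponent hα).symm.ne_zero
  set β := α.conjExponent
  have hfβ := hf.pow_const β
  have hm : Measurable fun y => ∫⁻ z, f z ^ β ∂κ' y :=
    (Measure.measurable_lintegral hfβ).comp hκ'
  rw [Measure.lintegral_bind hκ.aemeasurable hf.aemeasurable,
    Measure.lintegral_bind hκ'.aemeasurable hfβ.aemeasurable]
  calc ∫⁻ y, ∫⁻ z, f z ∂κ y ∂P
      ≤ ∫⁻ y, ENNReal.ofReal (Real.exp (ρ' / β)) * (∫⁻ z, f z ^ β ∂κ' y) ^ β⁻¹ ∂P :=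
        lintegral_mono fun y => h' y f hf
    _ = ENNReal.ofReal (Real.exp (ρ' / β)) * ∫⁻ y, (∫⁻ z, f z ^ β ∂κ' y) ^ β⁻¹ ∂P :=
        lintegral_const_mul _ (hm.pow_const _)
    _ ≤ ENNReal.ofReal (Real.exp (ρ' / β)) * (ENNReal.ofReal (Real.exp (ρ / β)) *
          (∫⁻ y, ((∫⁻ z, f z ^ β ∂κ' y) ^ β⁻¹) ^ β ∂Q) ^ β⁻¹) := by
        gcongr
        exact h _ (hm.pow_const _)
    _ = ENNReal.ofReal (Real.exp ((ρ + ρ') / β)) * (∫⁻ y, ∫⁻ z, f z ^ β ∂κ' y ∂Q) ^ β⁻¹ := by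
        simp_rw [ENNReal.rpow_inv_rpow hβ]
        rw [← mul_assoc, ofReal_exp_mul_ofReal_exp, ← add_div, add_comm]

theorem prod (hα : 1 < α) {P Q : Measure Y} {P' Q' : Measure Z} [SFinite P'] [SFinite Q']
    (h : RenyiDivLE α ρ P Q) (h' : RenyiDivLE α ρ' P' Q') :
    RenyiDivLE α (ρ + ρ') (P.prod P') (Q.prod Q') := by
  rw [Measure.prod, Measure.prod]
  exact h.bind hα Measurable.map_prodMk_left Measurable.map_prodMk_left
    fun _ => h'.map measurable_prodMk_left

theorem of_lossMoment_le (hα : 1 < α) {P Q : Measure Z} [SigmaFinite P] [SigmaFinite Q]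
    (h : lossMoment (α - 1) P Q ≤ ENNReal.ofReal (Real.exp ((α - 1) * ρ))) :
    RenyiDivLE α ρ P Q := by
  rw [lossMoment] at h
  split_ifs at h with hPQ
  · rw [← Measure.withDensity_rnDeriv_eq P Q hPQ]
    exact withDensity hα (Measure.measurable_rnDeriv P Q)
      (lintegral_rnDeriv_rpow_sub_one hα.le hPQ ▸ h)
  · exact absurd h (by simp)

theorem apply_le (hα : 1 < α) {P Q : Measure Z} (h : RenyiDivLE α ρ P Q) {s : Set Z}
    (hs : MeasurableSet s) :
    P s ≤ ENNReal.ofReal (Real.exp (ρ / α.conjExponent)) * Q s ^ α.conjExponent⁻¹ := by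
  have hβ := (Real.HolderConjugate.conjExponent hα).symm.pos
  have hpow : ∀ z, s.indicator (1 : Z → ℝ≥0∞) z ^ α.conjExponent = s.indicator 1 z := fun z => by
    by_cases hz : z ∈ s <;> simp [hz, hβ]
  simpa only [hpow, lintegral_indicator_one hs] using h _ (measurable_one.indicator hs)

theorem absolutelyContinuous (hα : 1 < α) {P Q : Measure Z} (h : RenyiDivLE α ρ P Q) :
    P ≪ Q := by
  refine Measure.AbsolutelyContinuous.mk fun s hs hQ => ?_
  have hβ := (Real.HolderConjugate.conjExponent hα).symm.inv_pos
  simpa [hQ, hβ] using h.apply_le hα hs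

theorem lossMoment_le (hα : 1 < α) {P Q : Measure Z} [IsFiniteMeasure P] [SigmaFinite Q]
    (h : RenyiDivLE α ρ P Q) :
    lossMoment (α - 1) P Q ≤ ENNReal.ofReal (Real.exp ((α - 1) * ρ)) := by
  have hPQ := h.absolutelyContinuous hα
  have hαβ := Real.HolderConjugate.conjExponent hα
  set β := α.conjExponent
  -- Simple functions below `(dP/dQ) ^ (α - 1)` have finite integrals, so the final bound may be
  -- divided by a power of the integral.
  rw [lossMoment, if_pos hPQ, lintegral_eq_nnreal]
  refine iSup₂_le fun φ hφ => ?_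
  set g : Z → ℝ≥0∞ := ⇑(φ.map ((↑) : ℝ≥0 → ℝ≥0∞))
  have hgm : Measurable g := SimpleFunc.measurable _
  have hgβ : ∀ z, g z ^ β ≤ P.rnDeriv Q z * g z := fun z => by
    have hβ_sub : β = (α - 1)⁻¹ + 1 := by
      rw [hαβ.conjugate_eq]; field [hαβ.sub_one_ne_zero]
    rw [hβ_sub, ENNReal.rpow_add_of_nonneg _ _ (inv_nonneg.2 hαβ.sub_one_pos.le) zero_le_one,
      ENNReal.rpow_one]
    gcongr
    exact (ENNReal.rpow_inv_le_iff hαβ.sub_one_pos).2 (hφ z)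
  have hgP : ∫⁻ z, g z ^ β ∂Q ≤ ∫⁻ z, g z ∂P := by
    rw [← lintegral_rnDeriv_mul hPQ hgm.aemeasurable]
    exact lintegral_mono hgβ
  have hfin : ∫⁻ z, g z ∂P < ⊤ := by
    obtain ⟨b, hb⟩ := φ.finite_range.bddAbove
    exact IsFiniteMeasure.lintegral_lt_top_of_bounded_to_ennreal P
      ⟨b, fun z => ENNReal.coe_le_coe.2 (hb (Set.mem_range_self z))⟩
  rw [← SimpleFunc.lintegral_eq_lintegral]
  have hself : ∫⁻ z, g z ∂P ≤ ENNReal.ofReal (Real.exp (ρ / β)) * (∫⁻ z, g z ∂P) ^ β⁻¹ :=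
    (h g hgm).trans (mul_le_mul_right (ENNReal.rpow_le_rpow hgP hαβ.symm.inv_nonneg) _)
  refine (le_rpow_of_le_mul_rpow_inv_conjExponent hα hfin.ne hself).trans_eq ?_
  rw [ofReal_exp_rpow, ← hαβ.div_conj_eq_sub_one, mul_comm_div, mul_comm]

theorem lintegral_rnDeriv_rpow_le (hα : 1 < α) {P Q : Measure Z} [IsFiniteMeasure P]
    [SigmaFinite Q] (h : RenyiDivLE α ρ P Q) :
    ∫⁻ z, P.rnDeriv Q z ^ α ∂Q ≤ ENNReal.ofReal (Real.exp ((α - 1) * ρ)) := by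
  have hPQ := h.absolutelyContinuous hα
  rw [← lintegral_rnDeriv_rpow_sub_one hα.le hPQ]
  simpa only [lossMoment, if_pos hPQ] using h.lossMoment_le hα

theorem apply_le_exp_mul_add (hα : 1 < α) {P Q : Measure Z} (h : RenyiDivLE α ρ P Q) {δ : ℝ}
    (hδ : 0 < δ) {s : Set Z} (hs : MeasurableSet s) :
    P s ≤ ENNReal.ofReal (Real.exp (ρ + Real.log (1 / δ) / (α - 1))) * Q s +
      ENNReal.ofReal δ := by
  have hαβ := Real.HolderConjugate.conjExponent hα
  set β := α.conjExponent
  set L := Real.log (1 / δ) with hL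
  set a := ENNReal.ofReal (Real.exp (-L / α))
  set b := ENNReal.ofReal (Real.exp ((ρ + L / (α - 1)) / β)) * Q s ^ β⁻¹
  have ha : a ^ α = ENNReal.ofReal δ := by
    rw [ofReal_exp_rpow, div_mul_cancel₀ _ hαβ.ne_zero, hL, one_div, Real.log_inv, neg_neg,
      Real.exp_log hδ]
  have hb : b ^ β = ENNReal.ofReal (Real.exp (ρ + L / (α - 1))) * Q s := by
    rw [ENNReal.mul_rpow_of_nonneg _ _ hαβ.symm.nonneg, ofReal_exp_rpow,
      div_mul_cancel₀ _ hαβ.symm.ne_zero, ENNReal.rpow_inv_rpow hαβ.symm.ne_zero]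
  have hab : ENNReal.ofReal (Real.exp (ρ / β)) * Q s ^ β⁻¹ = a * b := by
    rw [← mul_assoc, ofReal_exp_mul_ofReal_exp]
    congr 3
    rw [add_div, div_div L, hαβ.sub_one_mul_conj]
    ring
  calc P s ≤ ENNReal.ofReal (Real.exp (ρ / β)) * Q s ^ β⁻¹ := h.apply_le hα hs
    _ = a * b := hab
    _ ≤ a ^ α / ENNReal.ofReal α + b ^ β / ENNReal.ofReal β :=
        ENNReal.young_inequality a b hαβ
    _ ≤ a ^ α + b ^ β := by
        gcongr <;> refine ENNReal.div_le_of_le_mul (le_mul_of_one_le_right' ?_)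
        · exact ENNReal.one_le_ofReal.2 hαβ.lt.le
        · exact ENNReal.one_le_ofReal.2 hαβ.symm.lt.le
    _ = _ := by rw [ha, hb, add_comm]

end RenyiDivLE

section PrivacyLoss

variable {N : ℕ} {Aux X Z : Type*} [MeasurableSpace Z] {α ρ : ℝ}

theorem isDP_of_renyiDivLE (hα : 1 < α) {δ : ℝ} (hδ : 0 < δ) {M : (Fin N → X) → Measure Z}
    (h : ∀ D D', Adjacent D D' → RenyiDivLE α ρ (M D) (M D')) :
    IsDP M (ρ + Real.log (1 / δ) / (α - 1)) δ :=
  fun D D' hD _ hS => (h D D' hD).apply_le_exp_mul_add hα hδ hS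

theorem MA_ne_top (hα : 1 < α) {M : Aux → (Fin N → X) → Measure Z}
    [∀ a D, IsFiniteMeasure (M a D)]
    (h : ∀ a D D', Adjacent D D' → RenyiDivLE α ρ (M a D) (M a D')) : MA M (α - 1) ≠ ⊤ := by
  refine ne_top_of_le_ne_top (b := ENNReal.log (ENNReal.ofReal (Real.exp ((α - 1) * ρ)))) ?_ ?_
  · exact mt ENNReal.log_eq_top_iff.1 ENNReal.ofReal_ne_top
  · exact iSup_le fun a => iSup_le fun D => iSup_le fun D' => iSup_le fun hD =>
      ENNReal.log_monotone ((h a D D' hD).lossMoment_le hα)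

theorem renyiDivLE_of_MA_ne_top (hα : 1 < α) {M : Aux → (Fin N → X) → Measure Z}
    [∀ a D, SigmaFinite (M a D)] (h : MA M (α - 1) ≠ ⊤) (a : Aux) {D D' : Fin N → X}
    (hD : Adjacent D D') :
    RenyiDivLE α ((MA M (α - 1)).toReal / (α - 1)) (M a D) (M a D') := by
  refine RenyiDivLE.of_lossMoment_le hα ?_
  rw [mul_div_cancel₀ _ (sub_pos.2 hα).ne']
  have hle : ENNReal.log (lossMoment (α - 1) (M a D) (M a D')) ≤ MA M (α - 1) :=
    le_iSup_of_le a (le_iSup_of_le D (le_iSup_of_le D' (le_iSup_of_le hD le_rfl)))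
  have := EReal.exp_monotone (hle.trans (EReal.le_coe_toReal h))
  rwa [ENNReal.exp_log, EReal.exp_coe] at this

end PrivacyLoss

section Pi

variable {ι : Type*} [Fintype ι] {X : ι → Type*} [∀ i, MeasurableSpace (X i)]

theorem lintegral_pi_prod (Q : ∀ i, Measure (X i)) [∀ i, IsProbabilityMeasure (Q i)]
    {h : ∀ i, X i → ℝ≥0∞} (hh : ∀ i, Measurable (h i)) :
    ∫⁻ x, ∏ i, h i (x i) ∂Measure.pi Q = ∏ i, ∫⁻ y, h i y ∂Q i := by
  refine (lintegral_prod_eq_prod_lintegral_of_indepFun Finset.univ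
    (fun i (x : ∀ i, X i) => h i (x i)) (iIndepFun_pi fun i => (hh i).aemeasurable)
    fun i => by fun_prop).trans ?_
  exact Finset.prod_congr rfl fun i _ => (measurePreserving_eval Q i).lintegral_comp (hh i)

theorem pi_withDensity (Q : ∀ i, Measure (X i)) [∀ i, IsProbabilityMeasure (Q i)]
    {h : ∀ i, X i → ℝ≥0∞} (hh : ∀ i, Measurable (h i))
    [∀ i, SigmaFinite ((Q i).withDensity (h i))] :
    Measure.pi (fun i => (Q i).withDensity (h i)) =
      (Measure.pi Q).withDensity fun x => ∏ i, h i (x i) := by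
  classical
  refine Measure.pi_eq fun s hs => ?_
  have hbox : ∀ x, (Set.univ.pi s).indicator (fun x => ∏ i, h i (x i)) x =
      ∏ i, (s i).indicator (h i) (x i) := fun x => by
    simp [Set.indicator_apply, Finset.prod_ite_zero]
  rw [withDensity_apply _ (MeasurableSet.univ_pi hs),
    ← lintegral_indicator (MeasurableSet.univ_pi hs), lintegral_congr hbox,
    lintegral_pi_prod Q fun i => (hh i).indicator (hs i)]
  simp only [lintegral_indicator (hs _), withDensity_apply _ (hs _)]

theorem RenyiDivLE.pi {α : ℝ} (hα : 1 < α) {ρ : ι → ℝ} {P Q : ∀ i, Measure (X i)}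
    [∀ i, IsFiniteMeasure (P i)] [∀ i, IsProbabilityMeasure (Q i)]
    (h : ∀ i, RenyiDivLE α (ρ i) (P i) (Q i)) :
    RenyiDivLE α (∑ i, ρ i) (Measure.pi P) (Measure.pi Q) := by
  have hr := fun i => Measure.measurable_rnDeriv (P i) (Q i)
  have hP := fun i => Measure.withDensity_rnDeriv_eq (P i) (Q i) ((h i).absolutelyContinuous hα)
  have : ∀ i, SigmaFinite ((Q i).withDensity ((P i).rnDeriv (Q i))) :=
    fun i => by rw [hP i]; infer_instance
  have hpi := pi_withDensity Q hr
  simp only [hP] at hpi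
  rw [hpi]
  refine withDensity hα (by fun_prop) ?_
  calc ∫⁻ x, (∏ i, (P i).rnDeriv (Q i) (x i)) ^ α ∂Measure.pi Q
      = ∏ i, ∫⁻ y, (P i).rnDeriv (Q i) y ^ α ∂Q i := by
        simp_rw [← ENNReal.prod_rpow_of_nonneg (zero_le_one.trans hα.le)]
        exact lintegral_pi_prod Q fun i => (hr i).pow_const α
    _ ≤ ∏ i, ENNReal.ofReal (Real.exp ((α - 1) * ρ i)) :=
        Finset.prod_le_prod' fun i _ => (h i).lintegral_rnDeriv_rpow_le hα
    _ = ENNReal.ofReal (Real.exp ((α - 1) * ∑ i, ρ i)) := by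
        rw [← ENNReal.ofReal_prod_of_nonneg fun _ _ => Real.exp_nonneg _, ← Real.exp_sum,
          Finset.mul_sum]

end Pi

section Shift

theorem pi_map_add {ι : Type*} [Fintype ι] {X : ι → Type*} [∀ i, MeasurableSpace (X i)]
    [∀ i, Add (X i)] [∀ i, MeasurableAdd (X i)] (μ : ∀ i, Measure (X i))
    [∀ i, IsFiniteMeasure (μ i)] (u : ∀ i, X i) :
    (Measure.pi μ).map (u + ·) = Measure.pi fun i => (μ i).map (u i + ·) :=
  Measure.pi_map_pi fun i => (measurable_const_add (u i)).aemeasurable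

theorem RenyiDivLE.pi_map_add {ι : Type*} [Fintype ι] {X : ι → Type*}
    [∀ i, MeasurableSpace (X i)] [∀ i, Add (X i)] [∀ i, MeasurableAdd (X i)]
    {μ : ∀ i, Measure (X i)} [∀ i, IsProbabilityMeasure (μ i)] {α : ℝ} (hα : 1 < α) {ρ : ι → ℝ}
    {u u' : ∀ i, X i} (h : ∀ i, RenyiDivLE α (ρ i) ((μ i).map (u i + ·)) ((μ i).map (u' i + ·))) :
    RenyiDivLE α (∑ i, ρ i) ((Measure.pi μ).map (u + ·)) ((Measure.pi μ).map (u' + ·)) := by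
  have := fun i => Measure.isProbabilityMeasure_map (μ := μ i)
    (measurable_const_add (u' i)).aemeasurable
  rw [P3GM.pi_map_add, P3GM.pi_map_add]
  exact RenyiDivLE.pi hα h

theorem RenyiDivLE.prod_map_add {X Y : Type*} [MeasurableSpace X] [MeasurableSpace Y] [Add X]
    [Add Y] [MeasurableAdd X] [MeasurableAdd Y] {μ : Measure X} {ν : Measure Y} [SFinite μ]
    [SFinite ν] {α ρ ρ' : ℝ} (hα : 1 < α) {u u' : X × Y}
    (h : RenyiDivLE α ρ (μ.map (u.1 + ·)) (μ.map (u'.1 + ·)))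
    (h' : RenyiDivLE α ρ' (ν.map (u.2 + ·)) (ν.map (u'.2 + ·))) :
    RenyiDivLE α (ρ + ρ') ((μ.prod ν).map (u + ·)) ((μ.prod ν).map (u' + ·)) := by
  have hprod : ∀ u : X × Y,
      (μ.prod ν).map (u + ·) = (μ.map (u.1 + ·)).prod (ν.map (u.2 + ·)) := fun u =>
    (Measure.map_prod_map μ ν (measurable_const_add u.1) (measurable_const_add u.2)).symm
  rw [hprod, hprod]
  exact h.prod hα h'

end Shift

theorem gaussianReal_eq_withDensity (a b : ℝ) {v : ℝ≥0} (hv : v ≠ 0) :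
    gaussianReal a v = (gaussianReal b v).withDensity fun x =>
      ENNReal.ofReal (Real.exp ((a - b) / v * x - (a ^ 2 - b ^ 2) / (2 * v))) := by
  rw [gaussianReal_of_var_ne_zero _ hv, gaussianReal_of_var_ne_zero _ hv,
    ← withDensity_mul _ (measurable_gaussianPDF _ _) (by fun_prop)]
  congr 1
  ext x
  simp only [Pi.mul_apply, gaussianPDF, gaussianPDFReal]
  rw [← ENNReal.ofReal_mul (by positivity), mul_assoc (_)⁻¹, ← Real.exp_add]
  congr 3
  field [NNReal.coe_ne_zero.2 hv]

theorem lintegral_exp_mul_gaussianReal (b t : ℝ) (v : ℝ≥0) :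
    ∫⁻ x, ENNReal.ofReal (Real.exp (t * x)) ∂gaussianReal b v =
      ENNReal.ofReal (Real.exp (b * t + v * t ^ 2 / 2)) := by
  rw [← ofReal_integral_eq_lintegral_ofReal (integrable_exp_mul_gaussianReal t)
    (ae_of_all _ fun _ => Real.exp_nonneg _)]
  exact congrArg ENNReal.ofReal (congrFun mgf_fun_id_gaussianReal t)

theorem renyiDivLE_gaussianReal {α : ℝ} (hα : 1 < α) (a b : ℝ) {v : ℝ≥0} (hv : v ≠ 0) :
    RenyiDivLE α (α * ((a - b) ^ 2 / (2 * v))) (gaussianReal a v) (gaussianReal b v) := by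
  rw [gaussianReal_eq_withDensity a b hv]
  refine RenyiDivLE.withDensity hα (by fun_prop) (le_of_eq ?_)
  have hpow : ∀ x : ℝ,
      ENNReal.ofReal (Real.exp ((a - b) / v * x - (a ^ 2 - b ^ 2) / (2 * v))) ^ α =
        ENNReal.ofReal (Real.exp (-(α * (a ^ 2 - b ^ 2) / (2 * v)))) *
          ENNReal.ofReal (Real.exp (α * (a - b) / v * x)) := fun x => by
    rw [ofReal_exp_rpow, ofReal_exp_mul_ofReal_exp]
    ring_nf
  simp_rw [hpow]
  rw [lintegral_const_mul _ (by fun_prop), lintegral_exp_mul_gaussianReal,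
    ofReal_exp_mul_ofReal_exp]
  congr 2
  field [NNReal.coe_ne_zero.2 hv]

section GaussianNoise

variable {ι : Type*} [Fintype ι]

theorem sq_l2norm (v : ι → ℝ) : l2norm v ^ 2 = ∑ i, v i ^ 2 := by
  simp [l2norm, EuclideanSpace.norm_sq_eq]

theorem l2norm_nonneg (v : ι → ℝ) : 0 ≤ l2norm v := norm_nonneg _

instance (σ : ℝ) : IsProbabilityMeasure (gaussianNoise ι σ) := by
  unfold gaussianNoise; infer_instance

theorem map_add_gaussianNoise (σ : ℝ) (s : ι → ℝ) :
    (gaussianNoise ι σ).map (s + ·) =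
      Measure.pi fun i => gaussianReal (s i) (Real.toNNReal (σ ^ 2)) := by
  rw [gaussianNoise, pi_map_add]
  simp only [gaussianReal_map_const_add, zero_add]

theorem renyiDivLE_gaussianNoise {α : ℝ} (hα : 1 < α) {σ : ℝ} (hσ : σ ≠ 0) {s s' : ι → ℝ} {R : ℝ}
    (hR : l2norm (s - s') ≤ R) :
    RenyiDivLE α (α * (R ^ 2 / (2 * σ ^ 2)))
      ((gaussianNoise ι σ).map (s + ·)) ((gaussianNoise ι σ).map (s' + ·)) := by
  have hv : Real.toNNReal (σ ^ 2) ≠ 0 := by simpa using hσ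
  rw [map_add_gaussianNoise, map_add_gaussianNoise]
  refine (RenyiDivLE.pi hα fun i => renyiDivLE_gaussianReal hα (s i) (s' i) hv).mono hα ?_
  have : ∑ i, (s i - s' i) ^ 2 ≤ R ^ 2 := by
    simpa only [sq_l2norm, Pi.sub_apply] using pow_le_pow_left₀ (l2norm_nonneg _) hR 2
  rw [Real.coe_toNNReal _ (sq_nonneg σ), ← Finset.mul_sum, ← Finset.sum_div]
  gcongr

end GaussianNoise

theorem l2norm_le_l2norm_comp {ι κ : Type*} [Fintype ι] [Fintype κ] (v : ι → ℝ) {f : κ → ι}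
    (hf : f.Surjective) : l2norm v ≤ l2norm (v ∘ f) := by
  classical
  refine (sq_le_sq₀ (l2norm_nonneg _) (l2norm_nonneg _)).1 ?_
  rw [sq_l2norm, sq_l2norm]
  calc ∑ i, v i ^ 2 = ∑ k ∈ Finset.univ.image (Function.surjInv hf), v (f k) ^ 2 := by
        rw [Finset.sum_image (Function.injective_surjInv hf).injOn]
        simp only [Function.surjInv_eq]
    _ ≤ ∑ k, v (f k) ^ 2 :=
        Finset.sum_le_univ_sum_of_nonneg fun k => sq_nonneg (v (f k))

section SymmetricNoise

variable {n : ℕ}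

@[fun_prop]
theorem measurable_symm : Measurable (symm (n := n)) := by
  unfold symm; fun_prop

theorem exists_symm_eq {S : Fin n → Fin n → ℝ} (hS : ∀ i j, S i j = S j i) :
    ∃ e, symm e = S :=
  ⟨fun q => Sym2.lift ⟨S, hS⟩ q, rfl⟩

theorem renyiDivLE_map_symm_gaussianNoise {α : ℝ} (hα : 1 < α) {σ : ℝ} (hσ : σ ≠ 0)
    {S S' : Fin n → Fin n → ℝ} (hS : ∀ i j, S i j = S j i) (hS' : ∀ i j, S' i j = S' j i) {R : ℝ}
    (hR : l2norm (Function.uncurry (S - S')) ≤ R) :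
    RenyiDivLE α (α * (R ^ 2 / (2 * σ ^ 2)))
      (((gaussianNoise (Sym2 (Fin n)) σ).map symm).map (S + ·))
      (((gaussianNoise (Sym2 (Fin n)) σ).map symm).map (S' + ·)) := by
  obtain ⟨s, rfl⟩ := exists_symm_eq hS
  obtain ⟨s', rfl⟩ := exists_symm_eq hS'
  have hsub : l2norm (s - s') ≤ R :=
    (l2norm_le_l2norm_comp (s - s') Sym2.mk_surjective).trans hR
  have hcomm : ∀ t : Sym2 (Fin n) → ℝ,
      ((gaussianNoise (Sym2 (Fin n)) σ).map symm).map (symm t + ·) =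
        ((gaussianNoise (Sym2 (Fin n)) σ).map (t + ·)).map symm := fun t => by
    rw [Measure.map_map (measurable_const_add _) measurable_symm,
      Measure.map_map measurable_symm (measurable_const_add t)]
    rfl
  rw [hcomm, hcomm]
  exact (renyiDivLE_gaussianNoise hα hσ hsub).map measurable_symm

end SymmetricNoise

section Clip

variable {ι : Type*} [Fintype ι]

theorem l2norm_clip_le {C : ℝ} (hC : 0 < C) (v : ι → ℝ) : l2norm (clip C v) ≤ C := by
  have hpos : 0 < max 1 (l2norm v / C) := lt_max_of_lt_left one_pos
  have hscale : l2norm (clip C v) = (max 1 (l2norm v / C))⁻¹ * l2norm v := by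
    rw [l2norm, clip, WithLp.toLp_smul, norm_smul, norm_inv, Real.norm_of_nonneg hpos.le, l2norm]
  rw [hscale, inv_mul_le_iff₀ hpos, ← div_le_iff₀ hC]
  exact le_max_right _ _

theorem l2norm_sub_le (v w : ι → ℝ) : l2norm (v - w) ≤ l2norm v + l2norm w :=
  norm_sub_le (WithLp.toLp 2 v) (WithLp.toLp 2 w)

theorem l2norm_clip_sub_clip_le {C : ℝ} (hC : 0 < C) (v w : ι → ℝ) :
    l2norm (clip C v - clip C w) ≤ 2 * C :=
  (l2norm_sub_le _ _).trans (by linarith [l2norm_clip_le hC v, l2norm_clip_le hC w])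

@[fun_prop]
theorem measurable_clip (C : ℝ) : Measurable (clip C : (ι → ℝ) → ι → ℝ) := by
  have : Measurable fun v : ι → ℝ => l2norm v := by
    unfold l2norm; fun_prop
  unfold clip
  fun_prop

end Clip

section Param

variable {X Y Z : Type*} [MeasurableSpace X] [MeasurableSpace Y] [MeasurableSpace Z]

theorem measurable_bind {κ : X → Measure Y} (hκ : Measurable κ) [∀ x, IsProbabilityMeasure (κ x)]
    {η : X → Y → Measure Z} (hη : Measurable fun q : X × Y => η q.1 q.2) :
    Measurable fun x => (κ x).bind (η x) := by
  refine Measure.measurable_of_measurable_coe _ fun s hs => ?_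
  let k : Kernel X Y := ⟨κ, hκ⟩
  have : IsMarkovKernel k := ⟨inferInstance⟩
  have happly : ∀ x, (κ x).bind (η x) s = ∫⁻ y, η x y s ∂k x := fun x =>
    Measure.bind_apply hs (hη.comp measurable_prodMk_left).aemeasurable
  simp_rw [happly]
  exact Measurable.lintegral_kernel_prod_right (f := fun x y => η x y s)
    ((Measure.measurable_coe hs).comp hη)

theorem measurable_map {κ : X → Measure Y} (hκ : Measurable κ) [∀ x, IsProbabilityMeasure (κ x)]
    {f : X → Y → Z} (hf : Measurable fun q : X × Y => f q.1 q.2) :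
    Measurable fun x => (κ x).map (f x) := by
  have hdirac : ∀ x, (κ x).map (f x) = (κ x).bind fun y => Measure.dirac (f x y) := fun x =>
    (Measure.bind_dirac_eq_map _ (hf.comp measurable_prodMk_left)).symm
  simp_rw [hdirac]
  exact measurable_bind hκ (Measure.measurable_dirac.comp hf)

theorem map_prod_eq_bind (μ : Measure X) (ν : Measure Y) [IsProbabilityMeasure ν] {f : X × Y → Z}
    (hf : Measurable f) : (μ.prod ν).map f = μ.bind fun x => ν.map fun y => f (x, y) := by
  ext s hs
  rw [Measure.map_apply hf hs, Measure.prod_apply (hf hs), Measure.bind_apply hs]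
  · refine lintegral_congr fun x => ?_
    exact (Measure.map_apply (hf.comp measurable_prodMk_left) hs).symm
  · exact (measurable_map measurable_const (f := fun x y => f (x, y)) hf).aemeasurable

theorem sum_smul_eq_bind {ι : Type*} [Fintype ι] [MeasurableSpace ι] [DiscreteMeasurableSpace ι]
    (p : PMF ι) (κ : ι → Measure Z) : ∑ i, p i • κ i = p.toMeasure.bind κ := by
  ext s hs
  rw [Measure.bind_apply hs Measurable.of_discrete.aemeasurable, lintegral_fintype,
    Measure.finsetSum_apply]
  refine Finset.sum_congr rfl fun i _ => ?_
  rw [p.toMeasure_apply_singleton i (measurableSet_singleton i), Measure.smul_apply, smul_eq_mul,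
    mul_comm]

end Param

section EM

variable {X : Type*} [MeasurableSpace X]

theorem measurable_det {ι : Type*} [Fintype ι] [DecidableEq ι] {A : X → Matrix ι ι ℝ}
    (hA : ∀ i j, Measurable fun x => A x i j) : Measurable fun x => (A x).det := by
  simp only [Matrix.det_apply']
  fun_prop

theorem measurable_matrix_inv_apply {ι : Type*} [Fintype ι] [DecidableEq ι] {A : X → Matrix ι ι ℝ}
    (hA : ∀ i j, Measurable fun x => A x i j) (i j : ι) :
    Measurable fun x => (A x)⁻¹ i j := by
  simp only [Matrix.inv_def, Matrix.smul_apply, smul_eq_mul, Ring.inverse_eq_inv,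
    Matrix.adjugate_apply]
  refine (measurable_det hA).inv.mul (measurable_det fun k l => ?_)
  simp only [Matrix.updateRow_apply]
  split_ifs <;> fun_prop

variable {m : ℕ} {μ z : X → Fin m → ℝ} {S : X → Fin m → Fin m → ℝ}

@[fun_prop]
theorem measurable_mahalanobis (hμ : Measurable μ) (hS : Measurable S) (hz : Measurable z) :
    Measurable fun x => mahalanobis (μ x) (S x) (z x) := by
  have hinv (i j : Fin m) : Measurable fun x => (Matrix.of (S x))⁻¹ i j :=
    measurable_matrix_inv_apply (A := fun x => Matrix.of (S x))
      (fun i j => measurable_pi_iff.1 (measurable_pi_iff.1 hS i) j) i j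
  have hsub (i : Fin m) : Measurable fun x => z x i - μ x i := by fun_prop
  simp only [mahalanobis, dotProduct, Matrix.mulVec, Pi.sub_apply]
  exact Finset.measurable_fun_sum _ fun i _ => Measurable.fun_mul (hsub i) <|
    Finset.measurable_fun_sum _ fun j _ => Measurable.fun_mul (hinv i j) (hsub j)

@[fun_prop]
theorem measurable_gaussianDensity (hμ : Measurable μ) (hS : Measurable S) (hz : Measurable z) :
    Measurable fun x => gaussianDensity (μ x) (S x) (z x) := by
  have hdet := measurable_det (A := fun x => Matrix.of (S x)) fun i j => by
    simp only [Matrix.of_apply]; fun_prop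
  unfold gaussianDensity
  fun_prop

variable {K N : ℕ} {lam : X → MoG K m}

@[fun_prop]
theorem measurable_resp (hlam : Measurable lam) (hz : Measurable z) (k : Fin K) :
    Measurable fun x => resp (lam x) (z x) k := by
  unfold resp
  fun_prop

@[fun_prop]
theorem measurable_emUpdate (C : ℝ × ℝ × ℝ) {z : X → Fin N → Fin m → ℝ} (hlam : Measurable lam)
    (hz : Measurable z) : Measurable fun x => emUpdate C (lam x) (z x) := by
  unfold emUpdate mleWeight mleCov mleMean respSum Function.curry Function.uncurry
  fun_prop

theorem mleCov_comm (lam : MoG K m) (z : Fin N → Fin m → ℝ) (k : Fin K) (i j : Fin m) :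
    mleCov lam z k i j = mleCov lam z k j i := by
  simp only [mleCov, mul_comm (z _ i - _)]

end EM

section Covariance

open scoped RealInnerProductSpace

theorem sq_norm_le_of_norm_add_le_of_norm_sub_le {E : Type*} [NormedAddCommGroup E]
    [InnerProductSpace ℝ E] {c h : E} (hadd : ‖c + h‖ ≤ 1) (hsub : ‖c - h‖ ≤ 1) :
    ‖c‖ ^ 2 ≤ 1 - ‖h‖ ^ 2 - 2 * |⟪c, h⟫| := by
  have hadd' := norm_add_sq_real c h ▸ (sq_le_one_iff₀ (norm_nonneg _)).2 hadd
  have hsub' := norm_sub_sq_real c h ▸ (sq_le_one_iff₀ (norm_nonneg _)).2 hsub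
  cases abs_cases ⟪c, h⟫ <;> linarith

theorem abs_inner_le_of_norm_add_le_of_norm_sub_le {E : Type*} [NormedAddCommGroup E]
    [InnerProductSpace ℝ E] {c h : E} (hadd : ‖c + h‖ ≤ 1) (hsub : ‖c - h‖ ≤ 1) :
    |⟪c, h⟫| ≤ ‖h‖ * (1 - ‖h‖) := by
  have hc := sq_norm_le_of_norm_add_le_of_norm_sub_le hadd hsub
  have hcs := pow_le_pow_left₀ (abs_nonneg _) (abs_real_inner_le_norm c h) 2
  have hsq : (|⟪c, h⟫| + ‖h‖ ^ 2) ^ 2 ≤ ‖h‖ ^ 2 := by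
    nlinarith [mul_le_mul_of_nonneg_right hc (sq_nonneg ‖h‖)]
  linarith [abs_le_of_sq_le_sq' hsq (norm_nonneg h)]

-- With `u = x - w` and `v = y - w`, the left side is the squared Hilbert-Schmidt norm of
-- `u ⊗ u - v ⊗ v`.
theorem norm_pow_four_add_norm_pow_four_sub_inner_sq_le {E : Type*} [NormedAddCommGroup E]
    [InnerProductSpace ℝ E] {x y w : E} (hx : ‖x‖ ≤ 1) (hy : ‖y‖ ≤ 1) (hw : ‖w‖ ≤ 1) :
    ‖x - w‖ ^ 4 + ‖y - w‖ ^ 4 - 2 * ⟪x - w, y - w⟫ ^ 2 ≤ 16 := by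
  obtain ⟨c, h, rfl, rfl⟩ : ∃ c h : E, x = c + h ∧ y = c - h :=
    ⟨(2⁻¹ : ℝ) • (x + y), (2⁻¹ : ℝ) • (x - y), by module, by module⟩
  have hc := sq_norm_le_of_norm_add_le_of_norm_sub_le hx hy
  have hch := abs_inner_le_of_norm_add_le_of_norm_sub_le hx hy
  have hwh : |⟪w, h⟫| ≤ ‖h‖ :=
    (abs_real_inner_le_norm w h).trans (mul_le_of_le_one_left (norm_nonneg h) hw)
  have hcs : ⟪c + w, h⟫ ^ 2 ≤ ‖c + w‖ ^ 2 * ‖h‖ ^ 2 := by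
    rw [← mul_pow, ← sq_abs]
    gcongr
    exact abs_real_inner_le_norm _ _
  have hexpand : ‖c + h - w‖ ^ 4 + ‖c - h - w‖ ^ 4 - 2 * ⟪c + h - w, c - h - w⟫ ^ 2 =
      8 * (2 * ‖h‖ ^ 2 * (‖c‖ ^ 2 + ‖w‖ ^ 2) - 4 * ⟪c, h⟫ * ⟪w, h⟫ -
        (‖c + w‖ ^ 2 * ‖h‖ ^ 2 - ⟪c + w, h⟫ ^ 2)) := by
    have hpow (z : E) : ‖z‖ ^ 4 = ⟪z, z⟫ ^ 2 := by rw [real_inner_self_eq_norm_sq]; ring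
    simp only [hpow, ← real_inner_self_eq_norm_sq, inner_add_left, inner_add_right,
      inner_sub_left, inner_sub_right, real_inner_comm c h, real_inner_comm w h,
      real_inner_comm c w]
    ring
  have hprod : -(⟪c, h⟫ * ⟪w, h⟫) ≤ |⟪c, h⟫| * ‖h‖ :=
    (neg_le_abs _).trans ((abs_mul _ _).trans_le (by gcongr))
  calc _ ≤ 8 * (2 * ‖h‖ ^ 2 * (2 - ‖h‖ ^ 2 - 2 * |⟪c, h⟫|) + 4 * |⟪c, h⟫| * ‖h‖) := by
        have hw' : ‖w‖ ^ 2 ≤ 1 := (sq_le_one_iff₀ (norm_nonneg w)).2 hw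
        nlinarith [mul_le_mul_of_nonneg_left (add_le_add hc hw') (sq_nonneg ‖h‖)]
    _ ≤ 16 * (‖h‖ * (2 - ‖h‖)) ^ 2 := by
        have hh : 0 ≤ 1 - ‖h‖ := by nlinarith [abs_nonneg ⟪c, h⟫, sq_nonneg ‖c‖, norm_nonneg h]
        nlinarith [mul_le_mul_of_nonneg_right hch (mul_nonneg (norm_nonneg h) hh)]
    _ ≤ 16 := by
        have hh : ‖h‖ * (2 - ‖h‖) ≤ 1 := by nlinarith [sq_nonneg (1 - ‖h‖)]
        have hh' : 0 ≤ ‖h‖ * (2 - ‖h‖) := by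
          nlinarith [abs_nonneg ⟪c, h⟫, norm_nonneg h]
        nlinarith

/-- The outer square `u uᵀ`, flattened so that `l2norm` is its Frobenius norm. -/
def outer {ι : Type*} (u : ι → ℝ) : ι × ι → ℝ := fun q => u q.1 * u q.2

theorem outer_sub_comm {ι : Type*} (u v : ι → ℝ) : outer (u - v) = outer (v - u) := by
  ext q
  simp only [outer, Pi.sub_apply]
  ring

theorem outer_zero {ι : Type*} : outer (0 : ι → ℝ) = 0 := by
  ext q
  exact zero_mul _

theorem sq_l2norm_outer_sub_outer {ι : Type*} [Fintype ι] (u v : ι → ℝ) :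
    l2norm (outer u - outer v) ^ 2 = l2norm u ^ 4 + l2norm v ^ 4 - 2 * (∑ i, u i * v i) ^ 2 := by
  have hpow (w : ι → ℝ) : l2norm w ^ 4 = (∑ i, w i ^ 2) ^ 2 := by
    rw [← sq_l2norm]; ring
  rw [sq_l2norm, hpow, hpow, Fintype.sum_prod_type]
  rw [sq (∑ i, u i ^ 2), sq (∑ i, v i ^ 2), sq (∑ i, u i * v i),
    Finset.sum_mul_sum, Finset.sum_mul_sum, Finset.sum_mul_sum]
  simp only [Finset.mul_sum, ← Finset.sum_add_distrib,
    ← Finset.sum_sub_distrib]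
  refine Finset.sum_congr rfl fun i _ => Finset.sum_congr rfl fun j _ => ?_
  simp only [Pi.sub_apply, outer]
  ring

theorem l2norm_outer_sub_outer_le {d : ℕ} (x y w : Rec d) :
    l2norm (outer (x.1 - w.1) - outer (y.1 - w.1)) ≤ 4 := by
  have h := norm_pow_four_add_norm_pow_four_sub_inner_sq_le (x := WithLp.toLp 2 x.1)
    (y := WithLp.toLp 2 y.1) (w := WithLp.toLp 2 w.1) x.2 y.2 w.2
  rw [← WithLp.toLp_sub, ← WithLp.toLp_sub, EuclideanSpace.inner_toLp_toLp] at h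
  have hsq : l2norm (outer (x.1 - w.1) - outer (y.1 - w.1)) ^ 2 ≤ 16 := by
    rw [sq_l2norm_outer_sub_outer]
    simpa [dotProduct, mul_comm, l2norm] using h
  exact (sq_le_sq₀ (l2norm_nonneg _) (by norm_num)).1 (hsq.trans (by norm_num))

theorem uncurry_covariance {N d : ℕ} (D : Fin N → Rec d) :
    Function.uncurry (covariance D)
      = (2 * (N : ℝ) ^ 2)⁻¹ • ∑ n, ∑ n', outer ((D n).1 - (D n').1) := by
  ext ⟨i, j⟩
  obtain rfl | hN := N.eq_zero_or_pos
  · simp [covariance]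
  have hN' : (N : ℝ) ≠ 0 := Nat.cast_ne_zero.2 hN.ne'
  simp only [Function.uncurry_apply_pair, covariance, mean, outer, Pi.smul_apply, smul_eq_mul,
    Finset.sum_apply, Pi.sub_apply, sub_mul, mul_sub, Finset.sum_sub_distrib, Finset.sum_const,
    Finset.card_univ, Fintype.card_fin, nsmul_eq_mul, ← Finset.sum_mul, ← Finset.mul_sum]
  field_simp
  ring

theorem exists_forall_ne_eq_of_adjacent {N : ℕ} {X : Type*} {D D' : Fin N → X}
    (h : Adjacent D D') : ∃ a, ∀ n ≠ a, D n = D' n := by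
  classical
  obtain ⟨a, ha⟩ := Finset.card_eq_one.1 h
  refine ⟨a, fun n hn => by_contra fun hne => hn ?_⟩
  simpa using ha.subset (Finset.mem_filter.2 ⟨Finset.mem_univ n, hne⟩)

theorem sum_l2norm_outer_sub_outer_le {N d : ℕ} {D D' : Fin N → Rec d} {a : Fin N}
    (ha : ∀ n ≠ a, D n = D' n) :
    ∑ n, ∑ n', l2norm (outer ((D n).1 - (D n').1) - outer ((D' n).1 - (D' n').1))
      ≤ 8 * ((N : ℝ) - 1) := by
  let χ : Fin N → ℝ := fun n => if n = a then 1 else 0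
  have hpair (n n' : Fin N) :
      l2norm (outer ((D n).1 - (D n').1) - outer ((D' n).1 - (D' n').1))
        ≤ 4 * (χ n + χ n' - 2 * (χ n * χ n')) := by
    by_cases hn : n = a <;> by_cases hn' : n' = a
    · norm_num [χ, hn, hn', outer_zero, l2norm]
    · simpa [χ, hn, hn', ha n' hn'] using l2norm_outer_sub_outer_le (D a) (D' a) (D' n')
    · rw [outer_sub_comm, outer_sub_comm (D' n).1]
      simpa [χ, hn, hn', ha n hn] using l2norm_outer_sub_outer_le (D a) (D' a) (D' n)
    · simp [χ, hn, hn', ha n hn, ha n' hn', l2norm]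
  calc _ ≤ ∑ n, ∑ n', 4 * (χ n + χ n' - 2 * (χ n * χ n')) :=
        Finset.sum_le_sum fun n _ => Finset.sum_le_sum fun n' _ => hpair n n'
    _ = 8 * ((N : ℝ) - 1) := by
        simp only [mul_ite, mul_one, mul_zero, ← Finset.mul_sum, Finset.sum_sub_distrib,
          Finset.sum_add_distrib, Finset.sum_ite_irrel, Finset.sum_const, Finset.card_univ,
          Fintype.card_fin, nsmul_eq_mul, Finset.sum_ite_eq', Finset.mem_univ, ↓reduceIte, χ]
        ring

theorem l2norm_sum_le {ι κ : Type*} [Fintype ι] (s : Finset κ) (v : κ → ι → ℝ) :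
    l2norm (∑ k ∈ s, v k) ≤ ∑ k ∈ s, l2norm (v k) := by
  rw [l2norm, WithLp.toLp_sum]
  exact norm_sum_le _ _

theorem l2norm_smul {ι : Type*} [Fintype ι] (r : ℝ) (v : ι → ℝ) :
    l2norm (r • v) = |r| * l2norm v := by
  rw [l2norm, WithLp.toLp_smul, norm_smul, Real.norm_eq_abs, l2norm]

theorem l2norm_covariance_sub_le {N d : ℕ} {D D' : Fin N → Rec d} (h : Adjacent D D') :
    l2norm (Function.uncurry (covariance D - covariance D')) ≤ 1 := by
  obtain ⟨a, ha⟩ := exists_forall_ne_eq_of_adjacent h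
  have hN : (0 : ℝ) < N := Nat.cast_pos.2 a.pos
  have hcov : Function.uncurry (covariance D - covariance D') = (2 * (N : ℝ) ^ 2)⁻¹ •
      ∑ n, ∑ n', (outer ((D n).1 - (D n').1) - outer ((D' n).1 - (D' n').1)) := by
    simp only [Finset.sum_sub_distrib, smul_sub, ← uncurry_covariance]
    rfl
  calc _ ≤ (2 * (N : ℝ) ^ 2)⁻¹ * (8 * ((N : ℝ) - 1)) := by
        rw [hcov, l2norm_smul, abs_of_pos (by positivity)]
        gcongr
        exact (l2norm_sum_le _ _).trans <| (Finset.sum_le_sum fun n _ => l2norm_sum_le _ _).trans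
          (sum_l2norm_outer_sub_outer_le ha)
    _ ≤ 1 := by
        rw [inv_mul_le_iff₀ (by positivity)]
        nlinarith [sq_nonneg ((N : ℝ) - 2)]

theorem covariance_comm {N d : ℕ} (D : Fin N → Rec d) (i j : Fin d) :
    covariance D i j = covariance D j i := by
  simp only [covariance, mul_comm (_ - mean D i)]

theorem dpPCA_eq_map {N d : ℕ} (σ : ℝ) (D : Fin N → Rec d) :
    dpPCA σ D = ((gaussianNoise (Sym2 (Fin d)) σ).map symm).map (covariance D + ·) := by
  rw [Measure.map_map (measurable_const_add _) measurable_symm]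
  rfl

theorem renyiDivLE_dpPCA {α : ℝ} (hα : 1 < α) {σ : ℝ} (hσ : σ ≠ 0) {N d : ℕ}
    {D D' : Fin N → Rec d} (h : Adjacent D D') :
    RenyiDivLE α (α / (2 * σ ^ 2)) (dpPCA σ D) (dpPCA σ D') := by
  rw [dpPCA_eq_map, dpPCA_eq_map]
  refine (renyiDivLE_map_symm_gaussianNoise hα hσ (covariance_comm D) (covariance_comm D')
    (l2norm_covariance_sub_le h)).mono hα (le_of_eq ?_)
  ring

instance {N d : ℕ} (σ : ℝ) (D : Fin N → Rec d) : IsProbabilityMeasure (dpPCA σ D) :=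
  Measure.isProbabilityMeasure_map
    (measurable_symm.const_add (covariance D)).aemeasurable

end Covariance

instance measurableAdd₂_prod {X Y : Type*} [MeasurableSpace X] [MeasurableSpace Y] [Add X] [Add Y]
    [MeasurableAdd₂ X] [MeasurableAdd₂ Y] : MeasurableAdd₂ (X × Y) :=
  ⟨((measurable_fst.comp measurable_fst).add (measurable_fst.comp measurable_snd)).prodMk
    ((measurable_snd.comp measurable_fst).add (measurable_snd.comp measurable_snd))⟩

section EMNoise

variable {K m : ℕ} {C : ℝ × ℝ × ℝ} {σ : ℝ}

instance : IsProbabilityMeasure ((gaussianNoise (Sym2 (Fin m)) σ).map symm) :=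
  Measure.isProbabilityMeasure_map measurable_symm.aemeasurable

instance : IsProbabilityMeasure (emNoise K m C σ) := by
  unfold emNoise; infer_instance

theorem renyiDivLE_emNoise {α : ℝ} (hα : 1 < α) (hσ : σ ≠ 0) (hC₁ : 0 < C.1) (hC₂ : 0 < C.2.1)
    (hC₃ : 0 < C.2.2) {N : ℕ} (lam : MoG K m) (z z' : Fin N → Fin m → ℝ) :
    RenyiDivLE α ((2 * K + 1) * (α / (2 * σ ^ 2)))
      ((emNoise K m C σ).map (emUpdate C lam z + ·))
      ((emNoise K m C σ).map (emUpdate C lam z' + ·)) := by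
  have hsymm (z : Fin N → Fin m → ℝ) (k : Fin K) (i j : Fin m) :
      (emUpdate C lam z).2.2 k i j = (emUpdate C lam z).2.2 k j i := by
    simp only [emUpdate, clip, Function.curry_apply, Pi.smul_apply, Function.uncurry_apply_pair,
      mleCov_comm lam z k i j]
  have hweight := renyiDivLE_gaussianNoise hα (mul_ne_zero (mul_pos two_pos hC₁).ne' hσ)
    (l2norm_clip_sub_clip_le hC₁ (mleWeight lam z) (mleWeight lam z'))
  have hmean (k : Fin K) := renyiDivLE_gaussianNoise hα (mul_ne_zero (mul_pos two_pos hC₂).ne' hσ)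
    (l2norm_clip_sub_clip_le hC₂ (mleMean lam z k) (mleMean lam z' k))
  have hcov (k : Fin K) := renyiDivLE_map_symm_gaussianNoise hα
    (mul_ne_zero (mul_pos two_pos hC₃).ne' hσ) (hsymm z k) (hsymm z' k)
    (l2norm_clip_sub_clip_le hC₃ (Function.uncurry (mleCov lam z k)) _)
  refine (RenyiDivLE.prod_map_add hα hweight (RenyiDivLE.prod_map_add hα
    (RenyiDivLE.pi_map_add hα hmean) (RenyiDivLE.pi_map_add hα hcov))).mono hα (le_of_eq ?_)
  simp only [Finset.sum_const, Finset.card_univ, Fintype.card_fin, nsmul_eq_mul]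
  field

end EMNoise

namespace Config

variable {N d m p K L : ℕ} (c : Config N d m p K L) {α ρ : ℝ}

@[fun_prop]
theorem measurable_enc (hpca : Measurable c.pca) (x : Rec d) : Measurable fun A => c.enc A x := by
  unfold enc reduce
  fun_prop

section EM

instance (a : (Fin d → Fin d → ℝ) × MoG K m) (D : Fin N → Rec d) :
    IsProbabilityMeasure (c.emStep a D) :=
  Measure.isProbabilityMeasure_map (measurable_const_add _).aemeasurable

theorem measurable_emStep (hpca : Measurable c.pca) (D : Fin N → Rec d) :
    Measurable fun a => c.emStep a D := by
  have hupdate : Measurable fun a : (Fin d → Fin d → ℝ) × MoG K m =>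
      emUpdate c.clipEM a.2 fun n => c.enc a.1 (D n) :=
    measurable_emUpdate c.clipEM measurable_snd (by fun_prop)
  exact measurable_map measurable_const ((hupdate.comp measurable_fst).add measurable_snd)

theorem renyiDivLE_emStep (hα : 1 < α) (hσe : c.σe ≠ 0)
    (hclip : 0 < c.clipEM.1 ∧ 0 < c.clipEM.2.1 ∧ 0 < c.clipEM.2.2)
    (a : (Fin d → Fin d → ℝ) × MoG K m) (D D' : Fin N → Rec d) :
    RenyiDivLE α ((2 * K + 1) * (α / (2 * c.σe ^ 2))) (c.emStep a D) (c.emStep a D') :=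
  renyiDivLE_emNoise hα hσe hclip.1 hclip.2.1 hclip.2.2 a.2 _ _

theorem isProbabilityMeasure_dpEM (hpca : Measurable c.pca) (A : Fin d → Fin d → ℝ)
    (D : Fin N → Rec d) (t : ℕ) : IsProbabilityMeasure (c.dpEM A D t) := by
  induction t with
  | zero => exact Measure.dirac.isProbabilityMeasure
  | succ t ih =>
    exact isProbabilityMeasure_bind
      ((c.measurable_emStep hpca D).comp measurable_prodMk_left).aemeasurable
      (ae_of_all _ fun _ => inferInstance)

theorem measurable_dpEM (hpca : Measurable c.pca) (D : Fin N → Rec d) (t : ℕ) :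
    Measurable fun A => c.dpEM A D t := by
  induction t with
  | zero => exact measurable_const
  | succ t ih =>
    have := fun A => c.isProbabilityMeasure_dpEM hpca A D t
    exact measurable_bind ih (c.measurable_emStep hpca D)

theorem renyiDivLE_dpEM (hα : 1 < α) (hpca : Measurable c.pca) {D D' : Fin N → Rec d}
    (h : ∀ a, RenyiDivLE α ρ (c.emStep a D) (c.emStep a D')) (A : Fin d → Fin d → ℝ) (t : ℕ) :
    RenyiDivLE α (t * ρ) (c.dpEM A D t) (c.dpEM A D' t) := by
  induction t with
  | zero =>
    rw [Nat.cast_zero, zero_mul]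
    exact RenyiDivLE.refl hα (Measure.dirac c.lam₀)
  | succ t ih =>
    rw [Nat.cast_succ, add_one_mul]
    exact ih.bind hα ((c.measurable_emStep hpca D).comp measurable_prodMk_left)
      ((c.measurable_emStep hpca D').comp measurable_prodMk_left) fun lam => h (A, lam)

end EM

section SGD

/-- The gradient of the evidence lower bound is jointly measurable in all its arguments. -/
abbrev MeasurableGrad : Prop :=
  Measurable fun q : (Fin p → ℝ) × (Fin d → ℝ) × (Fin m → ℝ) × MoG K m × (Fin L → Fin m → ℝ) =>
    c.elboGrad q.1 q.2.1 q.2.2.1 q.2.2.2.1 q.2.2.2.2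

/-- The law of the Monte Carlo samples `ξ` drawn in one step of DP-SGD. -/
noncomputable def sampleLaw (N L m : ℕ) : Measure (Fin N → Fin L → Fin m → ℝ) :=
  Measure.pi fun _ => Measure.pi fun _ => gaussianNoise (Fin m) 1

instance : IsProbabilityMeasure (sampleLaw N L m) := by
  unfold sampleLaw; infer_instance

/-- The sum of the clipped gradients over the batch `S`, with the Monte Carlo samples `ξ`. -/
noncomputable def clippedSum (S : Finset (Fin N))
    (a : (Fin d → Fin d → ℝ) × MoG K m × (Fin p → ℝ)) (D : Fin N → Rec d)
    (ξ : Fin N → Fin L → Fin m → ℝ) : Fin p → ℝ :=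
  ∑ b ∈ S, clip c.C (c.elboGrad a.2.2 (D b).1 (c.enc a.1 (D b)) a.2.1 (ξ b))

/-- The law of the noisy sum of clipped gradients over the batch `S`: a Gaussian around
`clippedSum`, averaged over the Monte Carlo samples. -/
noncomputable def noisySum (S : Finset (Fin N))
    (a : (Fin d → Fin d → ℝ) × MoG K m × (Fin p → ℝ)) (D : Fin N → Rec d) :
    Measure (Fin p → ℝ) :=
  (sampleLaw N L m).bind fun ξ =>
    (gaussianNoise (Fin p) (c.σs * c.C)).map (c.clippedSum S a D ξ + ·)

theorem measurable_clippedSum (hpca : Measurable c.pca) (hgrad : c.MeasurableGrad)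
    (S : Finset (Fin N)) (D : Fin N → Rec d) :
    Measurable fun r : ((Fin d → Fin d → ℝ) × MoG K m × (Fin p → ℝ)) ×
      (Fin N → Fin L → Fin m → ℝ) => c.clippedSum S r.1 D r.2 := by
  refine Finset.measurable_fun_sum _ fun b _ => (measurable_clip c.C).comp ?_
  exact Measurable.comp hgrad (f := fun r : ((Fin d → Fin d → ℝ) × MoG K m × (Fin p → ℝ)) ×
    (Fin N → Fin L → Fin m → ℝ) => (r.1.2.2, (D b).1, c.enc r.1.1 (D b), r.1.2.1, r.2 b))
    (by fun_prop)

theorem measurable_map_clippedSum_add (hpca : Measurable c.pca) (hgrad : c.MeasurableGrad)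
    (S : Finset (Fin N)) (D : Fin N → Rec d) :
    Measurable fun r : ((Fin d → Fin d → ℝ) × MoG K m × (Fin p → ℝ)) ×
      (Fin N → Fin L → Fin m → ℝ) =>
        (gaussianNoise (Fin p) (c.σs * c.C)).map (c.clippedSum S r.1 D r.2 + ·) :=
  measurable_map measurable_const
    (((c.measurable_clippedSum hpca hgrad S D).comp measurable_fst).add measurable_snd)

theorem l2norm_clippedSum_sub_le (hC : 0 < c.C) {D D' : Fin N → Rec d} (h : Adjacent D D')
    (S : Finset (Fin N)) (a : (Fin d → Fin d → ℝ) × MoG K m × (Fin p → ℝ))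
    (ξ : Fin N → Fin L → Fin m → ℝ) :
    l2norm (c.clippedSum S a D ξ - c.clippedSum S a D' ξ) ≤ 2 * c.C := by
  obtain ⟨i, hi⟩ := exists_forall_ne_eq_of_adjacent h
  rw [clippedSum, clippedSum, ← Finset.sum_sub_distrib]
  by_cases hiS : i ∈ S
  · rw [Finset.sum_eq_single_of_mem i hiS fun b _ hb => by rw [hi b hb, sub_self]]
    exact l2norm_clip_sub_clip_le hC _ _
  · rw [Finset.sum_eq_zero fun b hb => by rw [hi b (ne_of_mem_of_not_mem hb hiS), sub_self]]
    simpa [l2norm] using hC.le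

theorem renyiDivLE_noisySum (hα : 1 < α) (hpca : Measurable c.pca) (hgrad : c.MeasurableGrad)
    (hσs : c.σs ≠ 0) (hC : 0 < c.C) (S : Finset (Fin N))
    (a : (Fin d → Fin d → ℝ) × MoG K m × (Fin p → ℝ)) {D D' : Fin N → Rec d}
    (h : Adjacent D D') :
    RenyiDivLE α (2 * α / c.σs ^ 2) (c.noisySum S a D) (c.noisySum S a D') := by
  refine ((RenyiDivLE.refl hα _).bind hα
    ((c.measurable_map_clippedSum_add hpca hgrad S D).comp measurable_prodMk_left)
    ((c.measurable_map_clippedSum_add hpca hgrad S D').comp measurable_prodMk_left)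
    fun ξ => renyiDivLE_gaussianNoise hα (mul_ne_zero hσs hC.ne')
      (c.l2norm_clippedSum_sub_le hC h S a ξ)).mono hα (le_of_eq ?_)
  field

theorem measurable_noisySum (hpca : Measurable c.pca) (hgrad : c.MeasurableGrad)
    (S : Finset (Fin N)) (D : Fin N → Rec d) : Measurable fun a => c.noisySum S a D :=
  measurable_bind measurable_const (c.measurable_map_clippedSum_add hpca hgrad S D)

theorem isProbabilityMeasure_noisySum (hpca : Measurable c.pca) (hgrad : c.MeasurableGrad)
    (S : Finset (Fin N)) (a : (Fin d → Fin d → ℝ) × MoG K m × (Fin p → ℝ)) (D : Fin N → Rec d) :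
    IsProbabilityMeasure (c.noisySum S a D) :=
  isProbabilityMeasure_bind
    ((c.measurable_map_clippedSum_add hpca hgrad S D).comp measurable_prodMk_left).aemeasurable
    (ae_of_all _ fun _ => Measure.isProbabilityMeasure_map (measurable_const_add _).aemeasurable)

theorem sgdStep_eq_bind (hpca : Measurable c.pca) (hgrad : c.MeasurableGrad)
    (a : (Fin d → Fin d → ℝ) × MoG K m × (Fin p → ℝ)) (D : Fin N → Rec d) :
    c.sgdStep a D =
      c.batch.toMeasure.bind fun S => (c.noisySum S a D).map ((c.B : ℝ)⁻¹ • ·) := by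
  rw [← sum_smul_eq_bind]
  refine Finset.sum_congr rfl fun S _ => congrArg _ ?_
  have hadd : Measurable fun w : (Fin N → Fin L → Fin m → ℝ) × (Fin p → ℝ) =>
      c.clippedSum S a D w.1 + w.2 :=
    ((c.measurable_clippedSum hpca hgrad S D).comp
      (measurable_const.prodMk measurable_fst)).add measurable_snd
  rw [noisySum, ← map_prod_eq_bind _ _ hadd, Measure.map_map (measurable_const_smul _) hadd]
  rfl

theorem measurable_sgdStep (hpca : Measurable c.pca) (hgrad : c.MeasurableGrad)
    (D : Fin N → Rec d) : Measurable fun a => c.sgdStep a D := by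
  simp_rw [c.sgdStep_eq_bind hpca hgrad]
  refine measurable_bind measurable_const (measurable_from_prod_countable_left fun S => ?_)
  have := fun a => c.isProbabilityMeasure_noisySum hpca hgrad S a D
  exact measurable_map (c.measurable_noisySum hpca hgrad S D)
    ((measurable_const_smul (c.B : ℝ)⁻¹).comp measurable_snd)

theorem isProbabilityMeasure_sgdStep (hpca : Measurable c.pca) (hgrad : c.MeasurableGrad)
    (a : (Fin d → Fin d → ℝ) × MoG K m × (Fin p → ℝ)) (D : Fin N → Rec d) :
    IsProbabilityMeasure (c.sgdStep a D) := by
  rw [c.sgdStep_eq_bind hpca hgrad]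
  refine isProbabilityMeasure_bind Measurable.of_discrete.aemeasurable (ae_of_all _ fun S => ?_)
  have := c.isProbabilityMeasure_noisySum hpca hgrad S a D
  exact Measure.isProbabilityMeasure_map (measurable_const_smul _).aemeasurable

theorem renyiDivLE_sgdStep (hα : 1 < α) (hpca : Measurable c.pca) (hgrad : c.MeasurableGrad)
    (hσs : c.σs ≠ 0) (hC : 0 < c.C) (a : (Fin d → Fin d → ℝ) × MoG K m × (Fin p → ℝ))
    {D D' : Fin N → Rec d} (h : Adjacent D D') :
    RenyiDivLE α (2 * α / c.σs ^ 2) (c.sgdStep a D) (c.sgdStep a D') := by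
  rw [c.sgdStep_eq_bind hpca hgrad, c.sgdStep_eq_bind hpca hgrad, ← zero_add (2 * α / _)]
  exact (RenyiDivLE.refl hα _).bind hα Measurable.of_discrete Measurable.of_discrete fun S =>
    (c.renyiDivLE_noisySum hα hpca hgrad hσs hC S a h).map (measurable_const_smul _)

theorem measurable_map_sgdStep (hpca : Measurable c.pca) (hgrad : c.MeasurableGrad)
    (D : Fin N → Rec d) (t : ℕ) :
    Measurable fun r : ((Fin d → Fin d → ℝ) × MoG K m) × (Fin p → ℝ) =>
      (c.sgdStep (r.1.1, r.1.2, r.2) D).map fun g => r.2 - c.η t • g := by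
  have := fun a => c.isProbabilityMeasure_sgdStep hpca hgrad a D
  exact measurable_map
    (κ := fun r : ((Fin d → Fin d → ℝ) × MoG K m) × (Fin p → ℝ) =>
      c.sgdStep (r.1.1, r.1.2, r.2) D)
    (f := fun r g => r.2 - c.η t • g)
    ((c.measurable_sgdStep hpca hgrad D).comp (by fun_prop)) (by fun_prop)

theorem isProbabilityMeasure_dpSGD (hpca : Measurable c.pca) (hgrad : c.MeasurableGrad)
    (A : Fin d → Fin d → ℝ) (lam : MoG K m) (D : Fin N → Rec d) (t : ℕ) :
    IsProbabilityMeasure (c.dpSGD A lam D t) := by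
  induction t with
  | zero => exact Measure.dirac.isProbabilityMeasure
  | succ t ih =>
    refine isProbabilityMeasure_bind ((c.measurable_map_sgdStep hpca hgrad D t).comp
      (measurable_prodMk_left (x := (A, lam)))).aemeasurable (ae_of_all _ fun θ => ?_)
    have := c.isProbabilityMeasure_sgdStep hpca hgrad (A, lam, θ) D
    exact Measure.isProbabilityMeasure_map (by fun_prop)

theorem measurable_dpSGD (hpca : Measurable c.pca) (hgrad : c.MeasurableGrad)
    (D : Fin N → Rec d) (t : ℕ) :
    Measurable fun r : (Fin d → Fin d → ℝ) × MoG K m => c.dpSGD r.1 r.2 D t := by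
  induction t with
  | zero => exact measurable_const
  | succ t ih =>
    have := fun r : (Fin d → Fin d → ℝ) × MoG K m =>
      c.isProbabilityMeasure_dpSGD hpca hgrad r.1 r.2 D t
    exact measurable_bind ih (c.measurable_map_sgdStep hpca hgrad D t)

theorem renyiDivLE_dpSGD (hα : 1 < α) (hpca : Measurable c.pca) (hgrad : c.MeasurableGrad)
    {D D' : Fin N → Rec d} (h : ∀ a, RenyiDivLE α ρ (c.sgdStep a D) (c.sgdStep a D'))
    (A : Fin d → Fin d → ℝ) (lam : MoG K m) (t : ℕ) :
    RenyiDivLE α (t * ρ) (c.dpSGD A lam D t) (c.dpSGD A lam D' t) := by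
  induction t with
  | zero =>
    rw [Nat.cast_zero, zero_mul]
    exact RenyiDivLE.refl hα (Measure.dirac c.θ₀)
  | succ t ih =>
    rw [Nat.cast_succ, add_one_mul]
    exact ih.bind hα
      ((c.measurable_map_sgdStep hpca hgrad D t).comp (measurable_prodMk_left (x := (A, lam))))
      ((c.measurable_map_sgdStep hpca hgrad D' t).comp (measurable_prodMk_left (x := (A, lam))))
      fun θ => (h (A, lam, θ)).map (by fun_prop)

end SGD

section Pipeline

theorem measurable_map_dpSGD (hpca : Measurable c.pca) (hgrad : c.MeasurableGrad)
    (D : Fin N → Rec d) (t : ℕ) :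
    Measurable fun r : (Fin d → Fin d → ℝ) × MoG K m =>
      (c.dpSGD r.1 r.2 D t).map fun θ => (θ, r.2) := by
  have := fun r : (Fin d → Fin d → ℝ) × MoG K m =>
    c.isProbabilityMeasure_dpSGD hpca hgrad r.1 r.2 D t
  exact measurable_map (f := fun r θ => (θ, r.2)) (c.measurable_dpSGD hpca hgrad D t)
    (by fun_prop)

theorem measurable_bind_dpEM (hpca : Measurable c.pca) (hgrad : c.MeasurableGrad)
    (D : Fin N → Rec d) (Te Ts : ℕ) :
    Measurable fun A => (c.dpEM A D Te).bind fun lam =>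
      (c.dpSGD A lam D Ts).map fun θ => (θ, lam) := by
  have := fun A => c.isProbabilityMeasure_dpEM hpca A D Te
  exact measurable_bind (c.measurable_dpEM hpca D Te) (c.measurable_map_dpSGD hpca hgrad D Ts)

theorem isProbabilityMeasure_p3gm (hpca : Measurable c.pca) (hgrad : c.MeasurableGrad)
    (Te Ts : ℕ) (D : Fin N → Rec d) : IsProbabilityMeasure (c.p3gm Te Ts D) := by
  refine isProbabilityMeasure_bind (c.measurable_bind_dpEM hpca hgrad D Te Ts).aemeasurable
    (ae_of_all _ fun A => ?_)
  have := c.isProbabilityMeasure_dpEM hpca A D Te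
  refine isProbabilityMeasure_bind
    ((c.measurable_map_dpSGD hpca hgrad D Ts).comp measurable_prodMk_left).aemeasurable
    (ae_of_all _ fun lam => ?_)
  have := c.isProbabilityMeasure_dpSGD hpca hgrad A lam D Ts
  exact Measure.isProbabilityMeasure_map measurable_prodMk_right.aemeasurable

theorem renyiDivLE_p3gm (hα : 1 < α) (hpca : Measurable c.pca) (hgrad : c.MeasurableGrad)
    (hσp : c.σp ≠ 0) {ρe ρs : ℝ} {D D' : Fin N → Rec d} (hD : Adjacent D D')
    (he : ∀ a, RenyiDivLE α ρe (c.emStep a D) (c.emStep a D'))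
    (hs : ∀ a, RenyiDivLE α ρs (c.sgdStep a D) (c.sgdStep a D')) (Te Ts : ℕ) :
    RenyiDivLE α (α / (2 * c.σp ^ 2) + (Te * ρe + Ts * ρs))
      (c.p3gm Te Ts D) (c.p3gm Te Ts D') :=
  (renyiDivLE_dpPCA hα hσp hD).bind hα (c.measurable_bind_dpEM hpca hgrad D Te Ts)
    (c.measurable_bind_dpEM hpca hgrad D' Te Ts) fun A =>
      (c.renyiDivLE_dpEM hα hpca he A Te).bind hα
        ((c.measurable_map_dpSGD hpca hgrad D Ts).comp measurable_prodMk_left)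
        ((c.measurable_map_dpSGD hpca hgrad D' Ts).comp measurable_prodMk_left) fun lam =>
          (c.renyiDivLE_dpSGD hα hpca hgrad hs A lam Ts).map measurable_prodMk_right

end Pipeline

end Config

end P3GM

theorem theorem4_general {N d m p K L : ℕ} (c : P3GM.Config N d m p K L)
    (hσp : 0 < c.σp) (hσe : 0 < c.σe) (hσs : 0 < c.σs) (hpca : Measurable c.pca)
    (hclip : 0 < c.clipEM.1 ∧ 0 < c.clipEM.2.1 ∧ 0 < c.clipEM.2.2) (hC : 0 < c.C)
    (hB : 0 < c.B) (hgrad : c.MeasurableGrad)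
    (Te Ts : ℕ) (α δ : ℝ) (hα : 1 < α) (hδ : 0 < δ) :
    (∀ D, IsProbabilityMeasure (c.p3gm Te Ts D)) ∧
    P3GM.MA c.emStep (α - 1) ≠ ⊤ ∧ P3GM.MA c.sgdStep (α - 1) ≠ ⊤ ∧
    P3GM.IsDP (c.p3gm Te Ts)
      (α / (2 * c.σp ^ 2)
        + Ts * ((P3GM.MA c.sgdStep (α - 1)).toReal / (α - 1))
        + Te * ((P3GM.MA c.emStep (α - 1)).toReal / (α - 1))
        + Real.log (1 / δ) / (α - 1)) δ := by
  have := c.isProbabilityMeasure_sgdStep hpca hgrad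
  have hEM : P3GM.MA c.emStep (α - 1) ≠ ⊤ :=
    P3GM.MA_ne_top hα fun a D D' _ => c.renyiDivLE_emStep hα hσe.ne' hclip a D D'
  have hSGD : P3GM.MA c.sgdStep (α - 1) ≠ ⊤ :=
    P3GM.MA_ne_top hα fun a _ _ hD => c.renyiDivLE_sgdStep hα hpca hgrad hσs.ne' hC a hD
  refine ⟨c.isProbabilityMeasure_p3gm hpca hgrad Te Ts, hEM, hSGD, ?_⟩
  refine P3GM.isDP_of_renyiDivLE hα hδ fun D D' hD => ?_
  rw [add_right_comm, add_assoc]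
  exact c.renyiDivLE_p3gm hα hpca hgrad hσp.ne' hD
    (fun a => P3GM.renyiDivLE_of_MA_ne_top hα hEM a hD)
    (fun a => P3GM.renyiDivLE_of_MA_ne_top hα hSGD a hD) Te Ts

theorem theorem4 {N d m p K L : ℕ} (c : P3GM.Config N d m p K L)
    (hσp : 0 < c.σp) (hσe : 0 < c.σe) (hσs : 0 < c.σs)
    (hpca : Measurable c.pca)
    (hpca' : ∀ S : Fin d → Fin d → ℝ, (Matrix.of S).IsSymm →
      P3GM.IsPrincipal (Matrix.of S) (Matrix.of (c.pca S)))
    (hclip : 0 < c.clipEM.1 ∧ 0 < c.clipEM.2.1 ∧ 0 < c.clipEM.2.2)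
    (hC : 0 < c.C)
    (hB : 0 < c.B) (hBN : c.B ≤ N)
    (hbatch : ∀ i : Fin N, ∑ S : Finset (Fin N) with i ∈ S, c.batch S = (c.B : ℝ≥0∞) / N)
    (hgrad : Measurable fun q : (Fin p → ℝ) × (Fin d → ℝ) × (Fin m → ℝ) × P3GM.MoG K m ×
      (Fin L → Fin m → ℝ) => c.elboGrad q.1 q.2.1 q.2.2.1 q.2.2.2.1 q.2.2.2.2)
    (Te Ts : ℕ) (α δ : ℝ) (hα : 1 < α) (hδ : 0 < δ) (hδ' : δ < 1) :
    (∀ D, IsProbabilityMeasure (c.p3gm Te Ts D)) ∧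
    P3GM.MA c.emStep (α - 1) ≠ ⊤ ∧ P3GM.MA c.sgdStep (α - 1) ≠ ⊤ ∧
    P3GM.IsDP (c.p3gm Te Ts)
      (α / (2 * c.σp ^ 2)
        + Ts * ((P3GM.MA c.sgdStep (α - 1)).toReal / (α - 1))
        + Te * ((P3GM.MA c.emStep (α - 1)).toReal / (α - 1))
        + Real.log (1 / δ) / (α - 1)) δ :=
  theorem4_general c hσp hσe hσs hpca hclip hC hB hgrad Te Ts α δ hα hδ
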